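/- For $M>1$ put $c=c(M)=\frac{2}{1+M^{-1}}$ and let $k_0,\Theta_1,\Theta_2:\mathbb R\to\mathbb R$ be the $2\pi$-periodic functions given on $[0,2\pi)$ by \[ k_0(\theta)=\begin{cases}1,&\theta\in[0,c\pi/2)\cup[\pi,\pi+c\pi/2),\\ M,&\text{otherwise,}\end{cases} \] \[ \Theta_1(\theta)=\begin{cases} \sin(c^{-1}\theta-\pi/4),&\theta\in[0,c\pi/2),\\ \cos(c^{-1}M(\theta-c\pi/2)-\pi/4),&\theta\in[c\pi/2,\pi),\\ -\sin(c^{-1}(\theta-\pi)-\pi/4),&\theta\in[\pi,\pi+c\pi/2),\\ -\cos(c^{-1}M(\theta-\pi-c\pi/2)-\pi/4),&\theta\in[\pi+c\pi/2,2\pi), \end{cases} \] \[ \Theta_2(\theta)=\begin{cases} -\cos(c^{-1}\theta-\pi/4),&\theta\in[0,c\pi/2),\\ \sin(c^{-1}M(\theta-c\pi/2)-\pi/4),&\theta\in[c\pi/2,\pi),\\ \cos(c^{-1}(\theta-\pi)-\pi/4),&\theta\in[\pi,\pi+c\pi/2),\\ -\sin(c^{-1}M(\theta-\pi-c\pi/2)-\pi/4),&\theta\in[\pi+c\pi/2,2\pi).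 \end{cases} \] Let $B\subset\mathbb R^2=\mathbb C$ be the open unit disk and, for $z\neq0$, let \[ f_0(z)=|z|^{1/c}\bigl(\Theta_1(\arg z)+i\,\Theta_2(\arg z)\bigr),\qquad \mu_0(z)=\frac{1-k_0(\arg z)}{1+k_0(\arg z)}\,\frac{z}{\bar z}, \] with $f_0(0)=\mu_0(0)=0$. (1) For every $M>1$: $f_0\in W^{1,2}(B,\mathbb C)$, $\mu_0\in L^\infty(B,\mathbb C)$ with $\|\mu_0\|_\infty<1$, and $f_0$ satisfies the Beltrami equation $\overline\partial f_0=\mu_0\,\partial f_0$ a.e. in $B$, where $\overline\partial=(\partial_1+i\partial_2)/2$, $\partial=(\partial_1-i\partial_2)/2$ and the derivatives are weak derivatives. (2) There exists $\bar M>1$ such that for every $M\in(1,\bar M)$ \[ \operatorname*{ess\,sup}_{S_\rho(x)\subset B}\ \frac{1}{|S_\rho(x)|}\int_{S_\rho(x)}\Bigl\{K_{\mu_0}-2\,\frac{|\mu_0|+\Re\bigl(\mu_0\,\overline{n^2}\bigr)}{1-|\mu_0|^2}\Bigr\}=c , \] where $S_\rho(x)$ is the circle with centre $x$ and radius $\rho>0$,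 $n(y)=(y-x)/\rho$ is its outer unit normal, $K_{\mu}=(1+|\mu|)/(1-|\mu|)$, all these integrals exist, and the essential supremum is taken with respect to Lebesgue measure in $(x,\rho)$ over all circles contained in $B$. Moreover, for these $M$, the number $1/c$, the reciprocal of this essential supremum, is exactly the best Hölder exponent of $f_0$: it is the greatest $\alpha\in(0,1)$ such that for every compact $T\subset B$ there is $C_T>0$ with $|f_0(z)-f_0(z')|\le C_T|z-z'|^\alpha$ for all $z,z'\in T$. -/

import Mathlib

open MeasureTheory Set Metric
open scoped ContDiff ComplexConjugate

noncomputable section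

/-! ### Sobolev functions and the Beltrami equation, with the plane identified with `ℂ` -/

/-- `g` is the weak derivative of `f` on the open set `Ω` in the direction `v`. -/
def IsWeakDeriv (Ω : Set ℂ) (v : ℂ) (f g : ℂ → ℂ) : Prop :=
  LocallyIntegrableOn f Ω ∧ LocallyIntegrableOn g Ω ∧
    ∀ φ : ℂ → ℝ, ContDiff ℝ ∞ φ → HasCompactSupport φ → tsupport φ ⊆ Ω →
      ∫ z in Ω, (fderiv ℝ φ z v) • f z = - ∫ z in Ω, φ z • g z

/-- `g₁ = ∂₁ f` and `g₂ = ∂₂ f` weakly on `Ω`. -/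
def HasWeakGradient (Ω : Set ℂ) (f g₁ g₂ : ℂ → ℂ) : Prop :=
  IsWeakDeriv Ω 1 f g₁ ∧ IsWeakDeriv Ω Complex.I f g₂

/-- The Sobolev class `W^{1,2}(Ω, ℂ)`. -/
def MemW12 (Ω : Set ℂ) (f : ℂ → ℂ) : Prop :=
  ∃ g₁ g₂ : ℂ → ℂ, HasWeakGradient Ω f g₁ g₂ ∧ MemLp f 2 (volume.restrict Ω) ∧
    MemLp g₁ 2 (volume.restrict Ω) ∧ MemLp g₂ 2 (volume.restrict Ω)

/-- `h ∈ L²_loc(Ω, ℂ)`. -/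
def MemL2Loc (Ω : Set ℂ) (h : ℂ → ℂ) : Prop :=
  ∀ T : Set ℂ, IsCompact T → T ⊆ Ω → MemLp h 2 (volume.restrict T)

/-- `μ ∈ L^∞(Ω, ℂ)` with `‖μ‖_∞ < 1`. -/
def IsBeltramiCoefficient (Ω : Set ℂ) (μ : ℂ → ℂ) : Prop :=
  AEStronglyMeasurable μ (volume.restrict Ω) ∧ eLpNorm μ ⊤ (volume.restrict Ω) < 1

/-- `f ∈ W^{1,2}_loc(Ω, ℂ)` and `(∂₁ f + i ∂₂ f) / 2 = μ (∂₁ f - i ∂₂ f) / 2` a.e. in `Ω`. -/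
def SolvesBeltrami (Ω : Set ℂ) (μ f : ℂ → ℂ) : Prop :=
  ∃ g₁ g₂ : ℂ → ℂ, HasWeakGradient Ω f g₁ g₂ ∧
    MemL2Loc Ω f ∧ MemL2Loc Ω g₁ ∧ MemL2Loc Ω g₂ ∧
    ∀ᵐ z ∂(volume.restrict Ω),
      (g₁ z + Complex.I * g₂ z) / 2 = μ z * ((g₁ z - Complex.I * g₂ z) / 2)

/-- `f` is `α`-Hölder continuous in `Ω`, i.e. on every compact subset of `Ω`. -/
def IsHolderIn (Ω : Set ℂ) (α : ℝ) (f : ℂ → ℂ) : Prop :=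
  ∀ T : Set ℂ, IsCompact T → T ⊆ Ω → ∃ C : ℝ, 0 < C ∧
    ∀ z ∈ T, ∀ z' ∈ T, z ≠ z' → ‖f z - f z'‖ / ‖z - z'‖ ^ α ≤ C

/-! ### The averages over circles -/

/-- The distortion function `K_μ = (1 + |μ|) / (1 - |μ|)`. -/
def distortion (μ : ℂ → ℂ) (z : ℂ) : ℝ := (1 + ‖μ z‖) / (1 - ‖μ z‖)

/-- The outer unit normal at the point `y` of the circle of centre `x` and radius `ρ`. -/
def circleNormal (x : ℂ) (ρ : ℝ) (y : ℂ) : ℂ := (y - x) / (ρ : ℂ)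

/-- `K_μ - 2 (|μ| + Re (μ, n²)) / (1 - |μ|²)` on the circle of centre `x` and radius `ρ`,
where `(a, b) = a * conj b`. -/
def circleIntegrand (μ : ℂ → ℂ) (x : ℂ) (ρ : ℝ) (y : ℂ) : ℝ :=
  distortion μ y -
    2 * ((‖μ y‖ + (μ y * conj (circleNormal x ρ y ^ 2)).re) / (1 - ‖μ y‖ ^ 2))

/-- The pairs `(x, ρ)` such that the circle of centre `x` and radius `ρ > 0` lies in `Ω`. -/
def circlesIn (Ω : Set ℂ) : Set (ℂ × ℝ) := {p | 0 < p.2 ∧ sphere p.1 p.2 ⊆ Ω}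

/-- The essential supremum, over all circles contained in `Ω` (with respect to Lebesgue measure
for the pair of centre and radius), of the average of the integrand above. -/
def essSupCircleAverage (Ω : Set ℂ) (μ : ℂ → ℂ) : EReal :=
  essSup (fun p : ℂ × ℝ =>
      ((Real.circleAverage (circleIntegrand μ p.1 p.2) p.1 p.2 : ℝ) : EReal))
    (volume.restrict (circlesIn Ω))

/-! ### The explicit map and the explicit coefficient -/

/-- `c = 2 / (1 + M⁻¹)`. -/
def cConst (M : ℝ) : ℝ := 2 / (1 + M⁻¹)

/-- The representative of the angle `θ` in `[0, 2π)`. -/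
def angle (θ : ℝ) : ℝ := toIcoMod Real.two_pi_pos 0 θ

/-- The `2π`-periodic function `k₀`. -/
def k₀ (M θ : ℝ) : ℝ :=
  open Classical in
  if angle θ ∈ Ico 0 (cConst M * Real.pi / 2) ∪
      Ico Real.pi (Real.pi + cConst M * Real.pi / 2) then 1 else M

/-- `Θ₁` on `[0, 2π)`, extended `2π`-periodically. -/
def Θ₁ (M θ : ℝ) : ℝ :=
  let c := cConst M
  let t := angle θ
  if t < c * Real.pi / 2 then Real.sin (c⁻¹ * t - Real.pi / 4)
  else if t < Real.pi then Real.cos (c⁻¹ * M * (t - c * Real.pi / 2) - Real.pi / 4)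
  else if t < Real.pi + c * Real.pi / 2 then
    -Real.sin (c⁻¹ * (t - Real.pi) - Real.pi / 4)
  else -Real.cos (c⁻¹ * M * (t - Real.pi - c * Real.pi / 2) - Real.pi / 4)

/-- `Θ₂` on `[0, 2π)`, extended `2π`-periodically. -/
def Θ₂ (M θ : ℝ) : ℝ :=
  let c := cConst M
  let t := angle θ
  if t < c * Real.pi / 2 then -Real.cos (c⁻¹ * t - Real.pi / 4)
  else if t < Real.pi then Real.sin (c⁻¹ * M * (t - c * Real.pi / 2) - Real.pi / 4)
  else if t < Real.pi + c * Real.pi / 2 then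
    Real.cos (c⁻¹ * (t - Real.pi) - Real.pi / 4)
  else -Real.sin (c⁻¹ * M * (t - Real.pi - c * Real.pi / 2) - Real.pi / 4)

/-- `f₀(z) = |z|^{1/c} (Θ₁(arg z) + i Θ₂(arg z))`; its value at `0` is `0`. -/
def f₀ (M : ℝ) (z : ℂ) : ℂ :=
  ((‖z‖ ^ (1 / cConst M) : ℝ) : ℂ) *
    ((Θ₁ M z.arg : ℂ) + Complex.I * (Θ₂ M z.arg : ℂ))

/-- `μ₀(z) = (1 - k₀(arg z)) / (1 + k₀(arg z)) * z / conj z`. -/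
def μ₀ (M : ℝ) (z : ℂ) : ℂ :=
  (((1 - k₀ M z.arg) / (1 + k₀ M z.arg) : ℝ) : ℂ) * (z * (conj z)⁻¹)

end

/-!
In polar form `f₀ = -i e^{-iπ/4} r^{1/c} exp (i ψ(θ))`, where `ψ` is piecewise linear with
`ψ' = k₀ / c` and maps `[0, 2π]` onto itself (`phase`, `f₀_eq_phase`). Everything about `f₀` follows
from this. The angular factor is Lipschitz on the circle and the radial factor is Hölder, so `f₀`
is Hölder with exponent `1 / c` (`norm_f₀_sub_le`); `‖f₀ z‖ = ‖z‖^{1/c}` shows that no exponent is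
better. On every horizontal or vertical line missing the origin `f₀` is continuous, and
differentiable at all but at most two points, with derivative `dirDeriv` of size `O(‖z‖^{1/c - 1})`;
since `1/c > 1/2` this is square integrable, and Fubini with the fundamental theorem of calculus
on lines makes it the weak derivative. The Beltrami equation is then an identity between complex
numbers.

For the circle averages, let `δ` be the angle between the position vector `y` and the normal `n` at
`y`, and `T = cos 2δ = Re ((y / ȳ) n̄²)` (`alignment`). The integrand is `k cos² δ + k⁻¹ sin² δ`,
with `k = k₀ (arg y)`.

* If the circle surrounds the origin, the doubled argument of `y` is uniformly distributed with
  respect to the arc length (`map_doubleArg`, a form of the intersecting chords theorem): on the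
  circle `y / ȳ` coincides with a holomorphic function of the disc vanishing at the centre, so all
  its Fourier coefficients but the zeroth vanish. Hence the average of `k₀` is exactly `c`, and as
  the integrand is at most `k₀`, its average is at most `c`. This holds for every `M > 1`. When the
  centre is close to the origin compared with the radius, `sin² δ` is uniformly small and the
  average is close to `c`, which gives the lower bound for the essential supremum.
* If the origin is outside, `T` is the real part of a holomorphic function, unimodular on the
  circle and vanishing at the centre, so `T` has average `0` and mean square `1 / 2`. The integrand
  is bounded by `1 + (M - 1) (M + 1)² / (16 M) * (1 + T)²`, whose average stays below `c` for `M`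
  close to `1`.

The circles through the origin form a null set of pairs (centre, radius).
-/

noncomputable section

/-! ### The constant `c` and the coefficient `k₀` -/

lemma cConst_eq {M : ℝ} (hM : 1 < M) : cConst M = 2 * M / (M + 1) := by
  have : M ≠ 0 := by positivity
  have : M + 1 ≠ 0 := by positivity
  unfold cConst
  field_simp

lemma one_lt_cConst {M : ℝ} (hM : 1 < M) : 1 < cConst M := by
  rw [cConst_eq hM, lt_div_iff₀ (by linarith)]
  linarith

lemma cConst_lt_two {M : ℝ} (hM : 1 < M) : cConst M < 2 := by
  rw [cConst_eq hM, div_lt_iff₀ (by linarith)]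
  linarith

lemma angle_mem (θ : ℝ) : angle θ ∈ Ico 0 (2 * Real.pi) := by
  simpa only [zero_add] using! toIcoMod_mem_Ico Real.two_pi_pos 0 θ

lemma angle_of_mem {θ : ℝ} (h : θ ∈ Ico 0 (2 * Real.pi)) : angle θ = θ :=
  (toIcoMod_eq_self Real.two_pi_pos).2 (by simpa using h)

lemma angle_add_int_mul (θ : ℝ) (n : ℤ) : angle (θ + n * (2 * Real.pi)) = angle θ := by
  simpa only [zsmul_eq_mul] using! toIcoMod_add_zsmul Real.two_pi_pos 0 θ n

lemma exists_eq_angle_add (θ : ℝ) : ∃ n : ℤ, θ = angle θ + n * (2 * Real.pi) :=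
  ⟨toIcoDiv Real.two_pi_pos 0 θ, by
    simpa only [zsmul_eq_mul] using! (toIcoMod_add_toIcoDiv_zsmul Real.two_pi_pos 0 θ).symm⟩

lemma measurable_angle : Measurable angle := by
  have : angle = fun θ ↦ Int.fract (θ / (2 * Real.pi)) * (2 * Real.pi) := by
    funext θ
    exact toIcoMod_eq_fract_mul _ θ
  rw [this]
  fun_prop

lemma measurable_k₀ (M : ℝ) : Measurable (k₀ M) := by
  unfold k₀
  exact Measurable.ite (measurable_angle (measurableSet_Ico.union measurableSet_Ico))
    measurable_const measurable_const

/-- The coefficient depends only on the doubled angle: this is the `π`-periodicity of `k₀`. -/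
lemma k₀_eq_ite {M : ℝ} (hM : 1 < M) (θ : ℝ) :
    k₀ M θ = if angle (2 * θ) < cConst M * Real.pi then 1 else M := by
  have hc := cConst_lt_two hM
  have hc1 := one_lt_cConst hM
  have hpi := Real.pi_pos
  obtain ⟨n, hn⟩ := exists_eq_angle_add θ
  obtain ⟨h0, h1⟩ := angle_mem θ
  have hcpi : cConst M * Real.pi < 2 * Real.pi := by nlinarith
  unfold k₀
  set t := angle θ
  rcases lt_or_ge t Real.pi with ht | ht
  · have : angle (2 * θ) = 2 * t := by
      rw [hn, show 2 * (t + n * (2 * Real.pi)) = 2 * t + ((2 * n : ℤ) : ℝ) * (2 * Real.pi) by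
        push_cast; ring, angle_add_int_mul]
      exact angle_of_mem ⟨by linarith, by linarith⟩
    rw [this]
    congr 1
    simp only [mem_union, mem_Ico, eq_iff_iff]
    constructor
    · rintro (⟨_, h⟩ | ⟨h, _⟩) <;> linarith
    · intro h
      exact Or.inl ⟨h0, by linarith⟩
  · have : angle (2 * θ) = 2 * t - 2 * Real.pi := by
      rw [hn, show 2 * (t + n * (2 * Real.pi)) =
        (2 * t - 2 * Real.pi) + ((2 * n + 1 : ℤ) : ℝ) * (2 * Real.pi) by
        push_cast; ring, angle_add_int_mul]
      exact angle_of_mem ⟨by linarith, by linarith⟩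
    rw [this]
    congr 1
    simp only [mem_union, mem_Ico, eq_iff_iff]
    constructor
    · rintro (⟨_, h⟩ | ⟨_, h⟩) <;> linarith
    · intro h
      exact Or.inr ⟨ht, by linarith⟩

lemma k₀_eq_one_or (M θ : ℝ) : k₀ M θ = 1 ∨ k₀ M θ = M := by
  unfold k₀
  split_ifs
  · exact Or.inl rfl
  · exact Or.inr rfl

lemma one_le_k₀ {M : ℝ} (hM : 1 < M) (θ : ℝ) : 1 ≤ k₀ M θ := by
  rcases k₀_eq_one_or M θ with h | h <;> linarith

lemma k₀_le {M : ℝ} (hM : 1 < M) (θ : ℝ) : k₀ M θ ≤ M := by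
  rcases k₀_eq_one_or M θ with h | h <;> linarith

lemma k₀_zero {M : ℝ} (hM : 1 < M) : k₀ M 0 = 1 := by
  have : 0 < cConst M * Real.pi := mul_pos (by linarith [one_lt_cConst hM]) Real.pi_pos
  rw [k₀_eq_ite hM, mul_zero, angle_of_mem ⟨le_rfl, Real.two_pi_pos⟩, if_pos this]

/-! ### The integrand on a circle -/

/-- The cosine of twice the angle between the position vector `y` and the outer normal at `y` of
the circle of centre `x` and radius `ρ`. -/
def alignment (x : ℂ) (ρ : ℝ) (y : ℂ) : ℝ :=
  (y * (conj y)⁻¹ * conj (circleNormal x ρ y ^ 2)).re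

lemma norm_circleNormal {x y : ℂ} {ρ : ℝ} (hρ : 0 < ρ) (hy : y ∈ sphere x ρ) :
    ‖circleNormal x ρ y‖ = 1 := by
  rw [mem_sphere, dist_eq_norm] at hy
  rw [circleNormal, norm_div, hy, Complex.norm_real, Real.norm_of_nonneg hρ.le, div_self hρ.ne']

lemma norm_mul_conj_inv_le (y : ℂ) : ‖y * (conj y)⁻¹‖ ≤ 1 := by
  rw [norm_mul, norm_inv, RCLike.norm_conj]
  exact mul_inv_le_one

lemma abs_alignment_le {x y : ℂ} {ρ : ℝ} (hρ : 0 < ρ) (hy : y ∈ sphere x ρ) :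
    |alignment x ρ y| ≤ 1 := by
  refine (Complex.abs_re_le_norm _).trans ?_
  rw [norm_mul, RCLike.norm_conj, norm_pow, norm_circleNormal hρ hy]
  simpa using norm_mul_conj_inv_le y

/-- Writing `T` for the alignment, the integrand is `k cos² + k⁻¹ sin²` of the angle between `y`
and the normal. -/
lemma circleIntegrand_eq {M : ℝ} (hM : 1 < M) (x : ℂ) (ρ : ℝ) (y : ℂ) :
    circleIntegrand (μ₀ M) x ρ y = 1 + (k₀ M y.arg - 1) / k₀ M y.arg *
      ((k₀ M y.arg + 1) * ((1 + alignment x ρ y) / 2) - 1) := by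
  rcases k₀_eq_one_or M y.arg with h | h
  · have : μ₀ M y = 0 := by simp [μ₀, h]
    simp [circleIntegrand, distortion, this, h]
  · have hy : y ≠ 0 := by
      rintro rfl
      rw [Complex.arg_zero, k₀_zero hM] at h
      exact hM.ne h
    have hM1 : M + 1 ≠ 0 := by positivity
    have hM0 : M ≠ 0 := by positivity
    have hn : ‖μ₀ M y‖ = (M - 1) / (M + 1) := by
      rw [μ₀, h, norm_mul, norm_mul, norm_inv, RCLike.norm_conj,
        mul_inv_cancel₀ (norm_ne_zero_iff.2 hy), Complex.norm_real, mul_one, Real.norm_eq_abs,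
        abs_div, abs_of_neg (by linarith), abs_of_pos (by linarith)]
      ring
    have hr : (μ₀ M y * conj (circleNormal x ρ y ^ 2)).re =
        (1 - M) / (1 + M) * alignment x ρ y := by
      rw [μ₀, h, mul_assoc, Complex.re_ofReal_mul, alignment]
    rw [circleIntegrand, distortion, hn, hr, h]
    have h1 : 1 - (M - 1) / (M + 1) = 2 / (M + 1) := by field_simp; ring
    have h2 : 1 - ((M - 1) / (M + 1)) ^ 2 = 4 * M / (M + 1) ^ 2 := by field_simp; ring
    have h3 : 1 + (M - 1) / (M + 1) = 2 * M / (M + 1) := by field_simp; ring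
    rw [h1, h2, h3, add_comm 1 M]
    field_simp
    ring

lemma circleIntegrand_le_k₀ {M : ℝ} (hM : 1 < M) {x y : ℂ} {ρ : ℝ} (hρ : 0 < ρ)
    (hy : y ∈ sphere x ρ) : circleIntegrand (μ₀ M) x ρ y ≤ k₀ M y.arg := by
  rw [circleIntegrand_eq hM]
  have hT := (abs_le.1 (abs_alignment_le hρ hy)).2
  rcases k₀_eq_one_or M y.arg with h | h
  · simp [h]
  · rw [h]
    have : (M - 1) / M * ((M + 1) * ((1 + alignment x ρ y) / 2) - 1) ≤ (M - 1) / M * M := by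
      refine mul_le_mul_of_nonneg_left ?_ (div_nonneg (by linarith) (by linarith))
      nlinarith
    rw [div_mul_cancel₀ _ (by positivity)] at this
    linarith

lemma k₀_sub_le_circleIntegrand {M : ℝ} (hM : 1 < M) {x y : ℂ} {ρ : ℝ} (hρ : 0 < ρ)
    (hy : y ∈ sphere x ρ) :
    k₀ M y.arg - (M ^ 2 - 1) * ((1 - alignment x ρ y) / 2) ≤ circleIntegrand (μ₀ M) x ρ y := by
  rw [circleIntegrand_eq hM]
  have hT := (abs_le.1 (abs_alignment_le hρ hy)).2
  rcases k₀_eq_one_or M y.arg with h | h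
  · rw [h]
    have : 0 ≤ (M ^ 2 - 1) * ((1 - alignment x ρ y) / 2) :=
      mul_nonneg (by nlinarith) (by linarith)
    simp only [sub_self, zero_div, zero_mul]
    linarith
  · rw [h]
    have h1 : (M - 1) / M * ((M + 1) * ((1 + alignment x ρ y) / 2) - 1) =
        (M - 1) - (M ^ 2 - 1) / M * ((1 - alignment x ρ y) / 2) := by
      have : M ≠ 0 := by positivity
      field_simp
      ring
    have h2 : (M ^ 2 - 1) / M * ((1 - alignment x ρ y) / 2) ≤
        (M ^ 2 - 1) * ((1 - alignment x ρ y) / 2) := by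
      exact mul_le_mul_of_nonneg_right (div_le_self (by nlinarith) hM.le) (by linarith)
    linarith

/-- The elementary inequality `(M + 1) s - 1 ≤ ((M + 1) / 2)² s²`, with `s = cos²`, replaces the
indicator of the sectors by a trigonometric polynomial. -/
lemma circleIntegrand_le_sq {M : ℝ} (hM : 1 < M) (x : ℂ) (ρ : ℝ) (y : ℂ) :
    circleIntegrand (μ₀ M) x ρ y ≤
      1 + (M - 1) / M * ((M + 1) ^ 2 / 16) * (1 + alignment x ρ y) ^ 2 := by
  rw [circleIntegrand_eq hM]
  have hM0 : 0 ≤ (M - 1) / M := div_nonneg (by linarith) (by linarith)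
  rcases k₀_eq_one_or M y.arg with h | h
  · rw [h]
    simp only [sub_self, zero_div, zero_mul, add_zero]
    have : 0 ≤ (M - 1) / M * ((M + 1) ^ 2 / 16) * (1 + alignment x ρ y) ^ 2 := by positivity
    linarith
  · rw [h, mul_assoc]
    gcongr
    nlinarith [sq_nonneg ((M + 1) * (1 + alignment x ρ y) / 4 - 1)]

lemma measurable_alignment (x : ℂ) (ρ : ℝ) : Measurable (alignment x ρ) := by
  unfold alignment circleNormal
  have := Complex.continuous_conj.measurable
  fun_prop

/-- A measurable function bounded on a circle is integrable over it. -/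
lemma circleIntegrable_of_bounded {g : ℂ → ℝ} (hg : Measurable g) {x : ℂ} {ρ C : ℝ}
    (hρ : 0 ≤ ρ) (hC : ∀ y ∈ sphere x ρ, |g y| ≤ C) : CircleIntegrable g x ρ := by
  rw [CircleIntegrable]
  refine (intervalIntegrable_const (c := C)).mono_fun ?_ ?_
  · exact (hg.comp (continuous_circleMap x ρ).measurable).aestronglyMeasurable
  · refine Filter.Eventually.of_forall fun θ ↦ ?_
    exact (hC _ (circleMap_mem_sphere x hρ θ)).trans (le_abs_self C)

lemma measurable_circleIntegrand {M : ℝ} (hM : 1 < M) (x : ℂ) (ρ : ℝ) :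
    Measurable (circleIntegrand (μ₀ M) x ρ) := by
  have h : Measurable fun y : ℂ ↦ k₀ M y.arg := (measurable_k₀ M).comp Complex.measurable_arg
  have h' := measurable_alignment x ρ
  rw [funext (circleIntegrand_eq hM x ρ)]
  fun_prop

lemma circleIntegrable_k₀ {M : ℝ} (hM : 1 < M) (x : ℂ) {ρ : ℝ} (hρ : 0 ≤ ρ) :
    CircleIntegrable (fun y ↦ k₀ M y.arg) x ρ :=
  circleIntegrable_of_bounded (C := M) ((measurable_k₀ M).comp Complex.measurable_arg) hρ
    fun y _ ↦ by
      have := one_le_k₀ hM y.arg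
      exact abs_le.2 ⟨by simp only [Function.comp_apply]; linarith, k₀_le hM _⟩

lemma circleIntegrable_circleIntegrand {M : ℝ} (hM : 1 < M) (x : ℂ) {ρ : ℝ} (hρ : 0 < ρ) :
    CircleIntegrable (circleIntegrand (μ₀ M) x ρ) x ρ := by
  refine circleIntegrable_of_bounded (C := M + M ^ 2) (measurable_circleIntegrand hM x ρ) hρ.le
    fun y hy ↦ abs_le.2 ⟨?_, ?_⟩
  · refine le_trans ?_ (k₀_sub_le_circleIntegrand hM hρ hy)
    have hT := (abs_le.1 (abs_alignment_le hρ hy)).1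
    have := one_le_k₀ hM y.arg
    have : (M ^ 2 - 1) * ((1 - alignment x ρ y) / 2) ≤ (M ^ 2 - 1) * 1 :=
      mul_le_mul_of_nonneg_left (by linarith) (by nlinarith)
    linarith
  · refine (circleIntegrand_le_k₀ hM hρ hy).trans ?_
    have := k₀_le hM y.arg
    nlinarith

/-! ### Circles surrounding the origin -/

/-- A finite measure on the circle is determined by its Fourier coefficients. -/
lemma AddCircle.measure_ext_of_integral_fourier {T : ℝ} [Fact (0 < T)]
    {μ ν : Measure (AddCircle T)} [IsFiniteMeasure μ] [IsFiniteMeasure ν]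
    (h : ∀ n : ℤ, ∫ u, fourier n u ∂μ = ∫ u, fourier n u ∂ν) : μ = ν := by
  have hint (κ : Measure (AddCircle T)) [IsFiniteMeasure κ] (f : C(AddCircle T, ℂ)) :
      Integrable f κ :=
    f.continuous.integrable_of_hasCompactSupport (HasCompactSupport.of_compactSpace _)
  have hcont (κ : Measure (AddCircle T)) [IsFiniteMeasure κ] :
      Continuous fun f : C(AddCircle T, ℂ) ↦ ∫ u, f u ∂κ := by
    refine continuous_iff_continuousAt.2 fun f ↦ ?_
    refine tendsto_integral_filter_of_dominated_convergence (fun _ ↦ ‖f‖ + 1) ?_ ?_ ?_ ?_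
    · exact Filter.Eventually.of_forall fun g ↦ g.continuous.aestronglyMeasurable
    · filter_upwards [Metric.ball_mem_nhds f one_pos] with g hg
      refine Filter.Eventually.of_forall fun u ↦ (g.norm_coe_le_norm u).trans ?_
      have := norm_le_norm_add_norm_sub' g f
      rw [mem_ball, dist_eq_norm] at hg
      linarith
    · exact integrable_const _
    · exact Filter.Eventually.of_forall fun u ↦ (continuous_eval_const u).tendsto f
  have hall (f : C(AddCircle T, ℂ)) : ∫ u, f u ∂μ = ∫ u, f u ∂ν := by
    have hf : f ∈ closure (Submodule.span ℂ (range (fourier (T := T))) : Set C(AddCircle T, ℂ)) := by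
      rw [← Submodule.topologicalClosure_coe, span_fourier_closure_eq_top]
      trivial
    refine closure_minimal (fun g hg ↦ ?_) (isClosed_eq (hcont μ) (hcont ν)) hf
    induction hg using Submodule.span_induction with
    | mem g hg => obtain ⟨n, rfl⟩ := hg; exact h n
    | zero => simp
    | add g₁ g₂ _ _ h₁ h₂ =>
      simp only [mem_ofPred_eq, ContinuousMap.add_apply] at *
      rw [integral_add (hint μ g₁) (hint μ g₂), integral_add (hint ν g₁) (hint ν g₂), h₁, h₂]
    | smul a g _ hg =>
      simp only [mem_ofPred_eq, ContinuousMap.smul_apply] at *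
      rw [integral_smul, integral_smul, hg]
  refine ext_of_forall_integral_eq_of_IsFiniteMeasure fun f ↦ ?_
  have := hall ⟨fun u ↦ (f u : ℂ), by fun_prop⟩
  simpa only [ContinuousMap.coe_mk, integral_complex_ofReal, Complex.ofReal_inj] using! this

lemma conj_eq_of_mem_sphere {x y : ℂ} {ρ : ℝ} (hρ : 0 < ρ) (hy : y ∈ sphere x ρ) :
    conj y = conj x + ρ ^ 2 / (y - x) := by
  rw [mem_sphere, dist_eq_norm] at hy
  have hne : y - x ≠ 0 := by
    rw [← norm_ne_zero_iff, hy]; exact hρ.ne'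
  have : (y - x) * conj (y - x) = ρ ^ 2 := by
    rw [Complex.mul_conj, Complex.normSq_eq_norm_sq, hy]; push_cast; ring
  rw [map_sub] at this
  field_simp
  linear_combination this

/-- On the circle, `y / conj y` agrees with a function holomorphic in the disc and vanishing at
the centre `x` (up to normalization, a Blaschke product of degree two), so the mean value property
kills its powers. -/
lemma circleAverage_pow_eq_zero {x : ℂ} {ρ : ℝ} (hx : ‖x‖ < ρ) {n : ℕ} (hn : n ≠ 0) :
    Real.circleAverage (fun y ↦ (y * (conj y)⁻¹) ^ n) x ρ = 0 := by
  have hρ : 0 < ρ := (norm_nonneg x).trans_lt hx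
  have hden (y : ℂ) (hy : y ∈ closedBall x ρ) : conj x * (y - x) + ρ ^ 2 ≠ 0 := by
    intro h
    rw [mem_closedBall, dist_eq_norm] at hy
    have h1 : ‖conj x * (y - x)‖ = ρ ^ 2 := by
      rw [eq_neg_of_add_eq_zero_left h, norm_neg, norm_pow, Complex.norm_real,
        Real.norm_of_nonneg hρ.le]
    rw [norm_mul, RCLike.norm_conj] at h1
    nlinarith [norm_nonneg x]
  have hcongr : EqOn (fun y ↦ (y * (conj y)⁻¹) ^ n)
      (fun y ↦ (y * (y - x) / (conj x * (y - x) + ρ ^ 2)) ^ n) (sphere x |ρ|) := by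
    intro y hy
    rw [abs_of_pos hρ] at hy
    have hne : y - x ≠ 0 := by
      rw [mem_sphere, dist_eq_norm] at hy
      rw [← norm_ne_zero_iff, hy]; exact hρ.ne'
    simp only
    rw [conj_eq_of_mem_sphere hρ hy]
    congr 1
    have := hden y (sphere_subset_closedBall hy)
    field_simp
  rw [Real.circleAverage_congr_sphere hcongr,
    circleAverage_of_differentiable_on_off_countable countable_empty]
  · simp [hn]
  · rw [abs_of_pos hρ]
    exact ContinuousOn.pow (ContinuousOn.div (by fun_prop) (by fun_prop) hden) n
  · intro y hy
    rw [abs_of_pos hρ] at hy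
    have := hden y (ball_subset_closedBall hy.1)
    fun_prop (disch := assumption)

instance : Fact (0 < 2 * Real.pi) := ⟨Real.two_pi_pos⟩

lemma fourier_two_mul_arg {y : ℂ} (hy : y ≠ 0) (n : ℕ) :
    fourier (n : ℤ) ((2 * y.arg : ℝ) : AddCircle (2 * Real.pi)) = (y * (conj y)⁻¹) ^ n := by
  have h : y * (conj y)⁻¹ = Complex.exp (2 * y.arg * Complex.I) := by
    have h1 := Complex.norm_mul_exp_arg_mul_I y
    have h2 : conj y = ‖y‖ * Complex.exp (-(y.arg * Complex.I)) := by
      conv_lhs => rw [← h1]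
      rw [map_mul, Complex.conj_ofReal, ← Complex.exp_conj]
      simp
    have h3 : (‖y‖ : ℂ) ≠ 0 := by exact_mod_cast norm_ne_zero_iff.2 hy
    rw [h2]
    conv_lhs => enter [1]; rw [← h1]
    rw [mul_inv, Complex.exp_neg, inv_inv, mul_mul_mul_comm, mul_inv_cancel₀ h3, one_mul,
      ← Complex.exp_add]
    congr 1
    ring
  rw [fourier_coe_apply, h, ← Complex.exp_nat_mul]
  congr 1
  have : (Real.pi : ℂ) ≠ 0 := by exact_mod_cast Real.pi_ne_zero
  push_cast
  field_simp

/-- The point of `AddCircle (2π)` given by twice the argument of a point on a circle. -/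
def doubleArg (x : ℂ) (ρ θ : ℝ) : AddCircle (2 * Real.pi) :=
  ((2 * (circleMap x ρ θ).arg : ℝ) : AddCircle (2 * Real.pi))

lemma measurable_doubleArg (x : ℂ) (ρ : ℝ) : Measurable (doubleArg x ρ) := by
  have h1 : Measurable fun θ ↦ 2 * (circleMap x ρ θ).arg :=
    (Complex.measurable_arg.comp (continuous_circleMap x ρ).measurable).const_mul 2
  exact AddCircle.measurable_mk'.comp h1

lemma circleMap_ne_zero_of_norm_lt {x : ℂ} {ρ : ℝ} (hx : ‖x‖ < ρ) (θ : ℝ) :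
    circleMap x ρ θ ≠ 0 := by
  intro h
  have := circleMap_mem_sphere x ((norm_nonneg x).trans hx.le) θ
  rw [h, mem_sphere, dist_zero_left] at this
  exact hx.ne this

/-- A circle surrounding the origin, parametrized by its central angle, has uniformly distributed
doubled argument. This is the intersecting chords theorem: a double sector at an interior point
cuts out arcs whose total angle does not depend on the point. -/
lemma map_doubleArg {x : ℂ} {ρ : ℝ} (hx : ‖x‖ < ρ) :
    Measure.map (doubleArg x ρ) (volume.restrict (Ioc 0 (2 * Real.pi))) =
      Measure.map (fun θ : ℝ ↦ (θ : AddCircle (2 * Real.pi)))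
        (volume.restrict (Ioc 0 (2 * Real.pi))) := by
  have hpi := Real.two_pi_pos
  have hleft (n : ℕ) (hn : n ≠ 0) :
      ∫ θ in Ioc 0 (2 * Real.pi), fourier (n : ℤ) (doubleArg x ρ θ) = 0 := by
    have h := circleAverage_pow_eq_zero hx hn
    rw [Real.circleAverage_def, smul_eq_zero, intervalIntegral.integral_of_le hpi.le] at h
    rw [← h.resolve_left (by positivity)]
    refine integral_congr_ae (Filter.Eventually.of_forall fun θ ↦ ?_)
    exact fourier_two_mul_arg (circleMap_ne_zero_of_norm_lt hx θ) n
  have hright (n : ℕ) (hn : n ≠ 0) :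
      ∫ θ in Ioc 0 (2 * Real.pi), fourier (n : ℤ) (θ : AddCircle (2 * Real.pi)) = 0 := by
    have h1 := AddCircle.intervalIntegral_preimage (2 * Real.pi) 0
      (fun u : AddCircle (2 * Real.pi) ↦ (fourier (n : ℤ) u : ℂ))
    rw [zero_add, intervalIntegral.integral_of_le hpi.le] at h1
    rw [h1]
    -- Translation by half a period of the character changes its sign.
    have h2 := integral_add_right_eq_self (μ := (volume : Measure (AddCircle (2 * Real.pi))))
      (fun u ↦ (fourier (n : ℤ) u : ℂ)) (((2 * Real.pi) / 2 / n : ℝ) : AddCircle (2 * Real.pi))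
    have h3 := fun u ↦ fourier_add_half_inv_index (n := (n : ℤ)) (by exact_mod_cast hn) hpi u
    simp only [Int.cast_natCast] at h3
    simp only [h3, integral_neg] at h2
    exact self_eq_neg.1 h2.symm
  refine AddCircle.measure_ext_of_integral_fourier fun m ↦ ?_
  rw [integral_map (measurable_doubleArg x ρ).aemeasurable
      (by exact (map_continuous (fourier m)).aestronglyMeasurable),
    integral_map AddCircle.measurable_mk'.aemeasurable
      (by exact (map_continuous (fourier m)).aestronglyMeasurable)]
  obtain ⟨n, rfl | rfl⟩ := m.eq_nat_or_neg
  · rcases eq_or_ne n 0 with rfl | hn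
    · simp
    · rw [hleft n hn, hright n hn]
  · rcases eq_or_ne n 0 with rfl | hn
    · simp
    · simp only [fourier_neg]
      rw [integral_conj, integral_conj, hleft n hn, hright n hn]

/-- The average of `k₀` over a circle surrounding the origin is `c`. -/
lemma circleAverage_k₀ {M : ℝ} (hM : 1 < M) {x : ℂ} {ρ : ℝ} (hx : ‖x‖ < ρ) :
    Real.circleAverage (fun y ↦ k₀ M y.arg) x ρ = cConst M := by
  have hpi := Real.two_pi_pos
  have hpi' := Real.pi_pos
  have hc := cConst_lt_two hM
  have hc1 := one_lt_cConst hM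
  set c := cConst M with hcdef
  let h : AddCircle (2 * Real.pi) → ℝ := fun u ↦
    if ((AddCircle.equivIco (2 * Real.pi) 0 u : ℝ)) < c * Real.pi then 1 else M
  have hh : Measurable h := by
    refine Measurable.ite (measurableSet_lt ?_ measurable_const) measurable_const measurable_const
    exact measurable_subtype_coe.comp (AddCircle.measurableEquivIco (2 * Real.pi) 0).measurable
  have hcoe (t : ℝ) : h (t : AddCircle (2 * Real.pi)) =
      if angle t < c * Real.pi then 1 else M := rfl
  have hl : ∫ u, h u ∂(Measure.map (doubleArg x ρ) (volume.restrict (Ioc 0 (2 * Real.pi)))) =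
      ∫ θ in Ioc 0 (2 * Real.pi), k₀ M (circleMap x ρ θ).arg := by
    rw [integral_map (measurable_doubleArg x ρ).aemeasurable hh.aestronglyMeasurable]
    refine integral_congr_ae (Filter.Eventually.of_forall fun θ ↦ ?_)
    simp only [doubleArg, hcoe, k₀_eq_ite hM, ← hcdef]
  have hcpi : c * Real.pi ≤ 2 * Real.pi := by nlinarith
  have hcpi0 : 0 ≤ c * Real.pi := by positivity
  have hr : ∫ u, h u ∂(Measure.map (fun θ : ℝ ↦ (θ : AddCircle (2 * Real.pi)))
        (volume.restrict (Ioc 0 (2 * Real.pi)))) = c * Real.pi + M * (2 * Real.pi - c * Real.pi) := by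
    rw [integral_map AddCircle.measurable_mk'.aemeasurable hh.aestronglyMeasurable,
      integral_Ioc_eq_integral_Ioo, ← integral_Ico_eq_integral_Ioo]
    have heq : ∀ θ ∈ Ico 0 (2 * Real.pi), h (θ : AddCircle (2 * Real.pi)) =
        (Ico 0 (c * Real.pi)).indicator (fun _ ↦ (1 : ℝ)) θ +
        (Ico (c * Real.pi) (2 * Real.pi)).indicator (fun _ ↦ M) θ := by
      intro θ hθ
      rw [hcoe, angle_of_mem hθ]
      obtain ⟨h0, h1⟩ := hθ
      by_cases hlt : θ < c * Real.pi
      · simp [hlt, h0, not_le.2 hlt]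
      · simp [hlt, not_lt.1 hlt, h1]
    rw [setIntegral_congr_fun measurableSet_Ico heq, integral_add]
    · rw [setIntegral_indicator measurableSet_Ico, setIntegral_indicator measurableSet_Ico,
        inter_eq_right.2 (Ico_subset_Ico_right hcpi), inter_eq_right.2 (Ico_subset_Ico_left hcpi0)]
      simp only [integral_const, smul_eq_mul, mul_one, measureReal_restrict_apply_univ,
        Real.volume_real_Ico_of_le hcpi0, Real.volume_real_Ico_of_le hcpi]
      ring
    all_goals exact (integrable_const _).indicator measurableSet_Ico
  rw [map_doubleArg hx, hr] at hl
  rw [Real.circleAverage_def, intervalIntegral.integral_of_le hpi.le, ← hl, hcdef, cConst_eq hM,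
    smul_eq_mul]
  have : M + 1 ≠ 0 := by positivity
  field_simp
  ring

/-- Circles surrounding the origin satisfy the upper bound for every `M > 1`. -/
lemma circleAverage_le_of_norm_lt {M : ℝ} (hM : 1 < M) {x : ℂ} {ρ : ℝ} (hx : ‖x‖ < ρ) :
    Real.circleAverage (circleIntegrand (μ₀ M) x ρ) x ρ ≤ cConst M := by
  have hρ : 0 < ρ := (norm_nonneg x).trans_lt hx
  rw [← circleAverage_k₀ hM hx]
  refine Real.circleAverage_mono (circleIntegrable_circleIntegrand hM x hρ)
    (circleIntegrable_k₀ hM x hρ.le) fun y hy ↦ ?_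
  rw [abs_of_pos hρ] at hy
  exact circleIntegrand_le_k₀ hM hρ hy

lemma one_sub_alignment_le {x y : ℂ} {ρ : ℝ} (hx : ‖x‖ < ρ) (hy : y ∈ sphere x ρ) :
    (1 - alignment x ρ y) / 2 ≤ (‖x‖ / (ρ - ‖x‖)) ^ 2 := by
  have hρ : 0 < ρ := (norm_nonneg x).trans_lt hx
  set n := circleNormal x ρ y with hn
  have hn1 : ‖n‖ = 1 := norm_circleNormal hρ hy
  have hyn : y = x + ρ * n := by
    have : (ρ : ℂ) ≠ 0 := by exact_mod_cast hρ.ne'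
    rw [hn, circleNormal]; field_simp; ring
  have hny : ρ - ‖x‖ ≤ ‖y‖ := by
    have : ‖(ρ : ℂ) * n‖ = ρ := by
      rw [norm_mul, hn1, Complex.norm_real, Real.norm_of_nonneg hρ.le, mul_one]
    have h2 := norm_sub_norm_le ((ρ : ℂ) * n) (-x)
    rw [norm_neg, sub_neg_eq_add, add_comm _ x, ← hyn, this] at h2
    exact h2
  have hy0 : 0 < ‖y‖ := by linarith
  -- `(1 - cos 2δ) / 2 = sin² δ`, where `sin δ = Im (y * conj n) / ‖y‖ = Im (x * conj n) / ‖y‖`.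
  have key : (1 - alignment x ρ y) / 2 = ((x * conj n).im / ‖y‖) ^ 2 := by
    have h1 : alignment x ρ y = ((y * conj n) ^ 2).re / ‖y‖ ^ 2 := by
      rw [alignment, ← hn, Complex.inv_def, Complex.conj_conj, Complex.normSq_conj,
        Complex.normSq_eq_norm_sq, map_pow,
        show y * (y * (((‖y‖ ^ 2)⁻¹ : ℝ) : ℂ)) * conj n ^ 2 =
          (((‖y‖ ^ 2)⁻¹ : ℝ) : ℂ) * (y * conj n) ^ 2 by ring, Complex.re_ofReal_mul]
      ring
    have h2 : (y * conj n).re ^ 2 + (y * conj n).im ^ 2 = ‖y‖ ^ 2 := by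
      have : ‖y * conj n‖ = ‖y‖ := by rw [norm_mul, RCLike.norm_conj, hn1, mul_one]
      rw [← this, ← Complex.normSq_eq_norm_sq, Complex.normSq_apply]
      ring
    have h3 : (y * conj n).im = (x * conj n).im := by
      rw [hyn, add_mul, mul_assoc, Complex.mul_conj, ← Complex.ofReal_mul, Complex.add_im,
        Complex.ofReal_im, add_zero]
    have h4 : ((y * conj n) ^ 2).re = (y * conj n).re ^ 2 - (y * conj n).im ^ 2 := by
      rw [sq, Complex.mul_re]; ring
    rw [h1, h4, ← h3, div_pow]
    field_simp
    linarith
  rw [key, sq_le_sq, abs_div, abs_of_pos hy0, abs_div, abs_of_nonneg (norm_nonneg x),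
    abs_of_pos (sub_pos.2 hx)]
  refine div_le_div₀ (norm_nonneg x) ?_ (sub_pos.2 hx) hny
  refine (Complex.abs_im_le_norm _).trans ?_
  rw [norm_mul, RCLike.norm_conj, hn1, mul_one]

lemma le_circleAverage_of_norm_lt {M : ℝ} (hM : 1 < M) {x : ℂ} {ρ : ℝ} (hx : ‖x‖ < ρ) :
    cConst M - (M ^ 2 - 1) * (‖x‖ / (ρ - ‖x‖)) ^ 2 ≤
      Real.circleAverage (circleIntegrand (μ₀ M) x ρ) x ρ := by
  have hρ : 0 < ρ := (norm_nonneg x).trans_lt hx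
  set D := (M ^ 2 - 1) * (‖x‖ / (ρ - ‖x‖)) ^ 2
  have hconst : CircleIntegrable (fun _ : ℂ ↦ D) x ρ := circleIntegrable_const D x ρ
  have h1 : Real.circleAverage (fun y ↦ k₀ M y.arg - D) x ρ = cConst M - D := by
    rw [Real.circleAverage_fun_sub (circleIntegrable_k₀ hM x hρ.le) hconst, circleAverage_k₀ hM hx,
      Real.circleAverage_const]
  rw [← h1]
  refine Real.circleAverage_mono ((circleIntegrable_k₀ hM x hρ.le).sub hconst)
    (circleIntegrable_circleIntegrand hM x hρ) fun y hy ↦ ?_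
  rw [abs_of_pos hρ] at hy
  refine le_trans ?_ (k₀_sub_le_circleIntegrand hM hρ hy)
  have := mul_le_mul_of_nonneg_left (one_sub_alignment_le hx hy)
    (show 0 ≤ M ^ 2 - 1 by nlinarith)
  exact sub_le_sub_left this _

/-! ### Circles not surrounding the origin -/

lemma conj_circleNormal_eq_inv {x y : ℂ} {ρ : ℝ} (hρ : 0 < ρ) (hy : y ∈ sphere x ρ) :
    conj (circleNormal x ρ y) = (circleNormal x ρ y)⁻¹ := by
  rw [Complex.inv_def, Complex.normSq_eq_norm_sq, norm_circleNormal hρ hy]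
  simp

/-- When the origin lies outside the closed disc, the alignment is the real part of a holomorphic
function which is unimodular on the circle and vanishes at its centre, so it has average `0` and
mean square `1 / 2`. -/
lemma circleAverage_one_add_alignment_sq {x : ℂ} {ρ : ℝ} (hρ : 0 < ρ) (hx : ρ < ‖x‖) :
    Real.circleAverage (fun y ↦ (1 + alignment x ρ y) ^ 2) x ρ = 3 / 2 := by
  let G : ℂ → ℂ := fun y ↦ circleNormal x ρ y * (conj x * circleNormal x ρ y + ρ) / y
  have hne (y : ℂ) (hy : y ∈ closedBall x ρ) : y ≠ 0 := by
    rintro rfl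
    rw [mem_closedBall, dist_zero_left] at hy
    linarith
  have hnormal : Differentiable ℂ (circleNormal x ρ) := by
    unfold circleNormal
    fun_prop
  have hdiff (y : ℂ) (hy : y ∈ closedBall x ρ) : DifferentiableAt ℂ G y := by
    have := hne y hy
    fun_prop (disch := assumption)
  have hG (y : ℂ) (hy : y ∈ sphere x ρ) : G y = conj (y * (conj y)⁻¹ * conj (circleNormal x ρ y ^ 2)) := by
    have h1 : circleNormal x ρ y ≠ 0 := by
      rw [← norm_ne_zero_iff, norm_circleNormal hρ hy]; exact one_ne_zero
    have h2 : conj y = conj x + ρ * conj (circleNormal x ρ y) := by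
      have : (ρ : ℂ) ≠ 0 := by exact_mod_cast hρ.ne'
      rw [← Complex.conj_ofReal ρ, ← map_mul, ← map_add]
      congr 1
      rw [circleNormal]; field_simp; ring
    rw [map_mul, map_mul, map_inv₀, Complex.conj_conj, Complex.conj_conj, h2,
      conj_circleNormal_eq_inv hρ hy]
    simp only [G]
    have := hne y (sphere_subset_closedBall hy)
    field_simp
  have hEq : EqOn (fun y ↦ (1 + alignment x ρ y) ^ 2)
      (fun y ↦ (3 / 2 + 2 * G y + G y ^ 2 / 2).re) (sphere x |ρ|) := by
    intro y hy
    rw [abs_of_pos hρ] at hy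
    have hre : alignment x ρ y = (G y).re := by rw [hG y hy, Complex.conj_re, alignment]
    have hnorm : (G y).re ^ 2 + (G y).im ^ 2 = 1 := by
      have : ‖G y‖ = 1 := by
        have := hne y (sphere_subset_closedBall hy)
        rw [hG y hy, RCLike.norm_conj, norm_mul, norm_mul, norm_inv, RCLike.norm_conj,
          RCLike.norm_conj, norm_pow, norm_circleNormal hρ hy,
          mul_inv_cancel₀ (norm_ne_zero_iff.2 this)]
        norm_num
      have h2 : Complex.normSq (G y) = 1 := by rw [Complex.normSq_eq_norm_sq, this, one_pow]
      rw [Complex.normSq_apply] at h2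
      linarith
    simp only
    rw [hre]
    have : (3 / 2 + 2 * G y + G y ^ 2 / 2).re =
        3 / 2 + 2 * (G y).re + ((G y).re ^ 2 - (G y).im ^ 2) / 2 := by
      have e1 : (3 / 2 + 2 * G y + G y ^ 2 / 2 : ℂ) =
        ((3 / 2 : ℝ) : ℂ) + ((2 : ℝ) : ℂ) * G y + ((1 / 2 : ℝ) : ℂ) * (G y * G y) := by
        push_cast; ring
      rw [e1, Complex.add_re, Complex.add_re, Complex.re_ofReal_mul, Complex.re_ofReal_mul,
        Complex.ofReal_re, Complex.mul_re]
      ring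
    rw [this]
    linarith
  have hd (y : ℂ) (hy : y ∈ closedBall x ρ) :
      DifferentiableAt ℂ (fun y ↦ 3 / 2 + 2 * G y + G y ^ 2 / 2) y := by
    have := hdiff y hy
    fun_prop
  have hcont : ContinuousOn (fun y ↦ 3 / 2 + 2 * G y + G y ^ 2 / 2) (closedBall x ρ) :=
    fun y hy ↦ (hd y hy).continuousAt.continuousWithinAt
  have hint : CircleIntegrable (fun y ↦ 3 / 2 + 2 * G y + G y ^ 2 / 2) x ρ :=
    (hcont.mono sphere_subset_closedBall).circleIntegrable hρ.le
  have havg : Real.circleAverage (fun y ↦ 3 / 2 + 2 * G y + G y ^ 2 / 2) x ρ = 3 / 2 := by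
    rw [circleAverage_of_differentiable_on_off_countable countable_empty]
    · simp [G, circleNormal]
    · rwa [abs_of_pos hρ]
    · rw [abs_of_pos hρ]
      exact fun y hy ↦ hd y (ball_subset_closedBall hy.1)
  have hre := Complex.reCLM.circleAverage_comp_comm hint
  rw [Real.circleAverage_congr_sphere hEq]
  refine hre.trans ?_
  rw [havg]
  norm_num

lemma circleAverage_le_of_lt_norm {M : ℝ} (hM : 1 < M) (hM' : M < 6 / 5) {x : ℂ} {ρ : ℝ}
    (hρ : 0 < ρ) (hx : ρ < ‖x‖) :
    Real.circleAverage (circleIntegrand (μ₀ M) x ρ) x ρ ≤ cConst M := by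
  set D := (M - 1) / M * ((M + 1) ^ 2 / 16) with hD
  have hsq : CircleIntegrable (fun y ↦ (1 + alignment x ρ y) ^ 2) x ρ := by
    have := measurable_alignment x ρ
    refine circleIntegrable_of_bounded (C := 4) (by fun_prop) hρ.le fun y hy ↦ ?_
    obtain ⟨h1, h2⟩ := abs_le.1 (abs_alignment_le hρ hy)
    rw [abs_of_nonneg (sq_nonneg _)]
    nlinarith
  have hsq' : CircleIntegrable (fun y ↦ D * (1 + alignment x ρ y) ^ 2) x ρ :=
    hsq.const_fun_smul
  have hint : CircleIntegrable (fun y ↦ 1 + D * (1 + alignment x ρ y) ^ 2) x ρ :=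
    (circleIntegrable_const 1 x ρ).add hsq'
  have hle : Real.circleAverage (circleIntegrand (μ₀ M) x ρ) x ρ ≤ 1 + D * (3 / 2) := by
    have : Real.circleAverage (fun y ↦ 1 + D * (1 + alignment x ρ y) ^ 2) x ρ =
        1 + D * (3 / 2) := by
      have h1 := Real.circleAverage_fun_smul (a := D) (f := fun y ↦ (1 + alignment x ρ y) ^ 2)
        (c := x) (R := ρ)
      simp only [smul_eq_mul] at h1
      rw [Real.circleAverage_fun_add (circleIntegrable_const 1 x ρ) hsq',
        Real.circleAverage_const, h1, circleAverage_one_add_alignment_sq hρ hx]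
    rw [← this]
    exact Real.circleAverage_mono (circleIntegrable_circleIntegrand hM x hρ) hint
      fun y _ ↦ circleIntegrand_le_sq hM x ρ y
  refine hle.trans ?_
  have hM1 : 0 < M + 1 := by linarith
  have hc : cConst M = 1 + (M - 1) / (M + 1) := by
    rw [cConst_eq hM]; field_simp; ring
  -- The claim reduces to `3 (M + 1)³ / 32 ≤ M`, and `3 (11 / 5)³ / 32 < 1`.
  have hcube : (M + 1) ^ 3 * 3 / 32 ≤ M := by
    have : (M + 1) ^ 3 ≤ (11 / 5) ^ 3 := pow_le_pow_left₀ hM1.le (by linarith) 3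
    linarith
  rw [hc, hD, add_le_add_iff_left, le_div_iff₀ hM1]
  calc (M - 1) / M * ((M + 1) ^ 2 / 16) * (3 / 2) * (M + 1)
      = (M - 1) / M * ((M + 1) ^ 3 * 3 / 32) := by ring
    _ ≤ (M - 1) / M * M := mul_le_mul_of_nonneg_left hcube
        (div_nonneg (by linarith) (by linarith))
    _ = M - 1 := div_mul_cancel₀ _ (by positivity)

/-! ### The essential supremum of the circle averages -/

lemma volume_setOf_norm_eq : volume {p : ℂ × ℝ | ‖p.1‖ = p.2} = 0 := by
  have hm : MeasurableSet {p : ℂ × ℝ | ‖p.1‖ = p.2} :=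
    measurableSet_eq_fun (by fun_prop) (by fun_prop)
  rw [Measure.volume_eq_prod, Measure.measure_prod_null hm]
  refine Filter.Eventually.of_forall fun x ↦ ?_
  have : Prod.mk x ⁻¹' {p : ℂ × ℝ | ‖p.1‖ = p.2} = {‖x‖} := by
    ext ρ
    simp [eq_comm]
  simp only [this, Real.volume_singleton, Pi.zero_apply]

lemma essSupCircleAverage_le {M : ℝ} (hM : 1 < M) (hM' : M < 6 / 5) (Ω : Set ℂ) :
    essSupCircleAverage Ω (μ₀ M) ≤ ((cConst M : ℝ) : EReal) := by
  refine essSup_le_of_ae_le _ ?_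
  have hpos : ∀ᵐ p ∂(volume.restrict (circlesIn Ω)), 0 < p.2 := by
    refine ae_mono (Measure.restrict_mono (fun p hp ↦ hp.1) le_rfl)
      (ae_restrict_mem (μ := volume) (s := {p : ℂ × ℝ | 0 < p.2}) ?_)
    exact measurableSet_lt measurable_const measurable_snd
  have hne : ∀ᵐ p ∂(volume.restrict (circlesIn Ω)), ‖p.1‖ ≠ p.2 :=
    ae_restrict_of_ae (measure_eq_zero_iff_ae_notMem.1 volume_setOf_norm_eq)
  filter_upwards [hpos, hne] with p hp hne
  rw [EReal.coe_le_coe_iff]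
  rcases lt_or_gt_of_ne hne with h | h
  · exact circleAverage_le_of_norm_lt hM h
  · exact circleAverage_le_of_lt_norm hM hM' hp h

lemma le_essSupCircleAverage {M : ℝ} (hM : 1 < M) :
    ((cConst M : ℝ) : EReal) ≤ essSupCircleAverage (ball 0 1) (μ₀ M) := by
  by_contra! hlt
  obtain ⟨r, hr, hrc⟩ := EReal.lt_iff_exists_real_btwn.1 hlt
  rw [EReal.coe_lt_coe_iff] at hrc
  have hae : ∀ᵐ p ∂(volume.restrict (circlesIn (ball (0 : ℂ) 1))),
      Real.circleAverage (circleIntegrand (μ₀ M) p.1 p.2) p.1 p.2 < r := by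
    filter_upwards [ae_lt_of_essSup_lt hr] with p hp
    exact EReal.coe_lt_coe_iff.1 hp
  have hM2 : 0 < M ^ 2 - 1 := by nlinarith
  -- Circles whose centre is within `η` radii of the origin have average close to `c`.
  obtain ⟨η, hη0, hη1, hη⟩ : ∃ η : ℝ, 0 < η ∧ η ≤ 1 / 2 ∧ (M ^ 2 - 1) * (2 * η) ≤ cConst M - r := by
    refine ⟨min (1 / 2) ((cConst M - r) / (2 * (M ^ 2 - 1))), ?_, min_le_left _ _, ?_⟩
    · exact lt_min (by norm_num) (div_pos (sub_pos.2 hrc) (by linarith))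
    · calc (M ^ 2 - 1) * (2 * min (1 / 2) ((cConst M - r) / (2 * (M ^ 2 - 1))))
          ≤ (M ^ 2 - 1) * (2 * ((cConst M - r) / (2 * (M ^ 2 - 1)))) := by
            gcongr; exact min_le_right _ _
        _ = cConst M - r := by field_simp
  let U : Set (ℂ × ℝ) := {p | ‖p.1‖ < η * p.2 ∧ 1 / 4 < p.2 ∧ p.2 < 1 / 2}
  have hUo : IsOpen U := 
    (isOpen_lt (f := fun p : ℂ × ℝ ↦ ‖p.1‖) (by fun_prop) (by fun_prop)).and
      ((isOpen_lt (f := fun _ ↦ (1 / 4 : ℝ)) (by fun_prop) (by fun_prop)).and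
        (isOpen_lt (g := fun _ ↦ (1 / 2 : ℝ)) (by fun_prop) (by fun_prop)))
  have hUne : U.Nonempty := ⟨(0, 3 / 8), by
    refine ⟨?_, by norm_num, by norm_num⟩
    simpa using hη0⟩
  have hUS : U ⊆ circlesIn (ball (0 : ℂ) 1) := by
    rintro ⟨x, ρ⟩ ⟨h1, h2, h3⟩
    simp only at h1 h2 h3
    refine ⟨by simp only; linarith, fun y hy ↦ ?_⟩
    simp only [mem_sphere, dist_eq_norm] at hy
    rw [mem_ball_zero_iff]
    have := norm_le_norm_add_norm_sub' y x
    nlinarith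
  have hUavg : ∀ p ∈ U, r ≤ Real.circleAverage (circleIntegrand (μ₀ M) p.1 p.2) p.1 p.2 := by
    rintro ⟨x, ρ⟩ ⟨h1, h2, h3⟩
    simp only at h1 h2 h3 ⊢
    have hx : ‖x‖ < ρ := by nlinarith
    refine le_trans ?_ (le_circleAverage_of_norm_lt hM hx)
    have hq : ‖x‖ / (ρ - ‖x‖) ≤ 2 * η := by
      rw [div_le_iff₀ (by linarith)]
      nlinarith [norm_nonneg x]
    have hq0 : 0 ≤ ‖x‖ / (ρ - ‖x‖) := div_nonneg (norm_nonneg x) (by linarith)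
    have hq2 : (‖x‖ / (ρ - ‖x‖)) ^ 2 ≤ 2 * η := by nlinarith
    have := mul_le_mul_of_nonneg_left hq2 hM2.le
    linarith
  have hnull : volume.restrict (circlesIn (ball (0 : ℂ) 1)) U = 0 := by
    refine measure_mono_null (fun p hp ↦ ?_) hae
    exact not_lt.2 (hUavg p hp)
  rw [Measure.restrict_apply hUo.measurableSet, inter_eq_left.2 hUS] at hnull
  exact (hUo.measure_pos volume hUne).ne' hnull

/-! ### The map `f₀` in polar form and its Hölder exponent -/

/-- The primitive of `c⁻¹ k₀` on `[0, 2π]` vanishing at `0`. -/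
def phase (M t : ℝ) : ℝ :=
  (cConst M)⁻¹ * (t + (M - 1) * (max (min t Real.pi - cConst M * Real.pi / 2) 0 +
    max (t - Real.pi - cConst M * Real.pi / 2) 0))

lemma inv_cConst_pos {M : ℝ} (hM : 1 < M) : 0 < (cConst M)⁻¹ :=
  inv_pos.2 (by linarith [one_lt_cConst hM])

lemma inv_cConst_lt_one {M : ℝ} (hM : 1 < M) : (cConst M)⁻¹ < 1 :=
  inv_lt_one_of_one_lt₀ (one_lt_cConst hM)

lemma half_lt_inv_cConst {M : ℝ} (hM : 1 < M) : 1 / 2 < (cConst M)⁻¹ := by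
  rw [one_div, inv_lt_inv₀ (by norm_num) (by linarith [one_lt_cConst hM])]
  exact cConst_lt_two hM

lemma inv_cConst_mul_eq {M : ℝ} (hM : 1 < M) :
    (cConst M)⁻¹ * M * (Real.pi - cConst M * Real.pi / 2) = Real.pi / 2 := by
  have : M + 1 ≠ 0 := by positivity
  rw [cConst_eq hM]
  field_simp
  ring

lemma phase_of_lt {M t : ℝ} (hM : 1 < M) (ht : t < cConst M * Real.pi / 2) :
    phase M t = (cConst M)⁻¹ * t := by
  have hpi := Real.pi_pos
  have h2 : t < Real.pi := by nlinarith [cConst_lt_two hM]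
  have h3 := one_lt_cConst hM
  have h4 : t - Real.pi - cConst M * Real.pi / 2 ≤ 0 := by nlinarith
  rw [phase, min_eq_left h2.le, max_eq_right (by linarith), max_eq_right h4]
  ring

lemma phase_of_mem_second {M t : ℝ} (hM : 1 < M) (ht : cConst M * Real.pi / 2 ≤ t)
    (ht' : t < Real.pi) :
    phase M t = (cConst M)⁻¹ * M * (t - cConst M * Real.pi / 2) + Real.pi / 2 := by
  have hpi := Real.pi_pos
  have h3 := one_lt_cConst hM
  have h4 : t - Real.pi - cConst M * Real.pi / 2 ≤ 0 := by nlinarith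
  rw [phase, min_eq_left ht'.le, max_eq_left (by linarith), max_eq_right h4]
  field_simp
  ring

lemma phase_of_mem_third {M t : ℝ} (hM : 1 < M) (ht : Real.pi ≤ t)
    (ht' : t < Real.pi + cConst M * Real.pi / 2) :
    phase M t = (cConst M)⁻¹ * (t - Real.pi) + Real.pi := by
  have hpi := Real.pi_pos
  have h2 := cConst_lt_two hM
  have h3 := one_lt_cConst hM
  rw [phase, min_eq_right ht, max_eq_left (by nlinarith), max_eq_right (by linarith)]
  have h4 : (cConst M)⁻¹ * cConst M = 1 := inv_mul_cancel₀ (by positivity)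
  linear_combination inv_cConst_mul_eq hM + Real.pi / 2 * h4

lemma phase_of_le {M t : ℝ} (hM : 1 < M) (ht : Real.pi + cConst M * Real.pi / 2 ≤ t) :
    phase M t = (cConst M)⁻¹ * M * (t - Real.pi - cConst M * Real.pi / 2) + 3 * Real.pi / 2 := by
  have hpi := Real.pi_pos
  have h2 := cConst_lt_two hM
  have h3 := one_lt_cConst hM
  have h5 : Real.pi ≤ t := by nlinarith
  rw [phase, min_eq_right h5, max_eq_left (by nlinarith), max_eq_left (by linarith)]
  have h4 : (cConst M)⁻¹ * cConst M = 1 := inv_mul_cancel₀ (by positivity)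
  linear_combination inv_cConst_mul_eq hM + Real.pi * h4

lemma phase_zero {M : ℝ} (hM : 1 < M) : phase M 0 = 0 := by
  rw [phase_of_lt hM, mul_zero]
  have := one_lt_cConst hM
  positivity

lemma phase_two_pi {M : ℝ} (hM : 1 < M) : phase M (2 * Real.pi) = 2 * Real.pi := by
  rw [phase_of_le hM]
  · linear_combination inv_cConst_mul_eq hM
  · nlinarith [cConst_lt_two hM, Real.pi_pos]

lemma phase_mono {M t t' : ℝ} (hM : 1 < M) (h : t ≤ t') : phase M t ≤ phase M t' := by
  have hc := inv_cConst_pos hM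
  have hM' : 0 ≤ M - 1 := by linarith
  unfold phase
  gcongr

lemma phase_sub_le {M t t' : ℝ} (hM : 1 < M) (h : t ≤ t') :
    phase M t' - phase M t ≤ (cConst M)⁻¹ * M * (t' - t) := by
  have hb : 0 < cConst M * Real.pi / 2 := by
    have := one_lt_cConst hM
    positivity
  have key (b : ℝ) (hb : 0 < b) : (max (min t' Real.pi - b) 0 + max (t' - Real.pi - b) 0) -
      (max (min t Real.pi - b) 0 + max (t - Real.pi - b) 0) ≤ t' - t := by
    grind
  have := mul_le_mul_of_nonneg_left (key _ hb) (show 0 ≤ M - 1 by linarith)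
  have := mul_le_mul_of_nonneg_left this (inv_cConst_pos hM).le
  unfold phase
  linarith

lemma Θ_eq_phase {M : ℝ} (hM : 1 < M) (θ : ℝ) :
    (Θ₁ M θ : ℂ) + Complex.I * (Θ₂ M θ : ℂ) =
      Complex.exp (Complex.I * ((phase M (angle θ) - 3 * Real.pi / 4 : ℝ) : ℂ)) := by
  suffices h : Θ₁ M θ = Real.cos (phase M (angle θ) - 3 * Real.pi / 4) ∧
      Θ₂ M θ = Real.sin (phase M (angle θ) - 3 * Real.pi / 4) by
    rw [h.1, h.2, mul_comm Complex.I (Complex.ofReal (Real.sin _)), Complex.ofReal_cos,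
      Complex.ofReal_sin, ← Complex.exp_mul_I, mul_comm Complex.I]
  simp only [Θ₁, Θ₂]
  set t := angle θ
  split_ifs with h1 h2 h3
  · rw [phase_of_lt hM h1,
      show (cConst M)⁻¹ * t - 3 * Real.pi / 4 = (cConst M)⁻¹ * t - Real.pi / 4 - Real.pi / 2 by ring,
      Real.cos_sub_pi_div_two, Real.sin_sub_pi_div_two]
    exact ⟨rfl, rfl⟩
  · rw [phase_of_mem_second hM (not_lt.1 h1) h2, add_sub_assoc,
      show Real.pi / 2 - 3 * Real.pi / 4 = -(Real.pi / 4) by ring, ← sub_eq_add_neg]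
    exact ⟨rfl, rfl⟩
  · rw [phase_of_mem_third hM (not_lt.1 h2) h3,
      show (cConst M)⁻¹ * (t - Real.pi) + Real.pi - 3 * Real.pi / 4 =
        (cConst M)⁻¹ * (t - Real.pi) - Real.pi / 4 + Real.pi / 2 by ring,
      Real.cos_add_pi_div_two, Real.sin_add_pi_div_two]
    exact ⟨rfl, rfl⟩
  · rw [phase_of_le hM (not_lt.1 h3),
      show (cConst M)⁻¹ * M * (t - Real.pi - cConst M * Real.pi / 2) + 3 * Real.pi / 2 -
        3 * Real.pi / 4 = (cConst M)⁻¹ * M * (t - Real.pi - cConst M * Real.pi / 2) - Real.pi / 4 +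
          Real.pi by ring,
      Real.cos_add_pi, Real.sin_add_pi]
    exact ⟨rfl, rfl⟩

lemma f₀_eq_phase {M : ℝ} (hM : 1 < M) (z : ℂ) :
    f₀ M z = ((‖z‖ ^ (cConst M)⁻¹ : ℝ) : ℂ) *
      Complex.exp (Complex.I * ((phase M (angle z.arg) - 3 * Real.pi / 4 : ℝ) : ℂ)) := by
  rw [f₀, Θ_eq_phase hM, one_div]

lemma norm_f₀ {M : ℝ} (hM : 1 < M) (z : ℂ) : ‖f₀ M z‖ = ‖z‖ ^ (cConst M)⁻¹ := by
  rw [f₀_eq_phase hM, norm_mul, Complex.norm_exp_I_mul_ofReal, mul_one, Complex.norm_real,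
    Real.norm_of_nonneg (by positivity)]

lemma norm_exp_sub_exp (s t : ℝ) :
    ‖Complex.exp (Complex.I * (t : ℂ)) - Complex.exp (Complex.I * (s : ℂ))‖ =
      ‖Complex.exp (Complex.I * ((t - s : ℝ) : ℂ)) - 1‖ := by
  have : Complex.exp (Complex.I * (t : ℂ)) - Complex.exp (Complex.I * (s : ℂ)) =
      Complex.exp (Complex.I * (s : ℂ)) * (Complex.exp (Complex.I * ((t - s : ℝ) : ℂ)) - 1) := by
    rw [mul_sub, mul_one, ← Complex.exp_add]
    congr 2
    push_cast
    ring
  rw [this, norm_mul, Complex.norm_exp_I_mul_ofReal, one_mul]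

lemma norm_exp_phase_sub_le_of_le {M t t' : ℝ} (hM : 1 < M) (ht : 0 ≤ t) (htt' : t ≤ t')
    (ht' : t' < 2 * Real.pi) :
    ‖Complex.exp (Complex.I * (phase M t' : ℂ)) - Complex.exp (Complex.I * (phase M t : ℂ))‖ ≤
      (cConst M)⁻¹ * M * (Real.pi / 2) *
        ‖Complex.exp (Complex.I * (t' : ℂ)) - Complex.exp (Complex.I * (t : ℂ))‖ := by
  have hpi := Real.pi_pos
  rw [norm_exp_sub_exp, norm_exp_sub_exp, Complex.norm_exp_I_mul_ofReal_sub_one (t' - t)]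
  set L := (cConst M)⁻¹ * M with hL
  have hL0 : 0 < L := mul_pos (inv_cConst_pos hM) (by linarith)
  -- The chord of an arc of length `x ≤ π` is at least `2 x / π`.
  have jordan (x : ℝ) (hx0 : 0 ≤ x) (hx : x ≤ Real.pi) :
      x ≤ Real.pi / 2 * (2 * Real.sin (x / 2)) := by
    have h := Real.mul_le_sin (x := x / 2) (by linarith) (by linarith)
    have h2 := mul_le_mul_of_nonneg_left h hpi.le
    have h3 : Real.pi * (2 / Real.pi * (x / 2)) = x := by field_simp
    linarith
  have hsin : 0 ≤ Real.sin ((t' - t) / 2) :=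
    Real.sin_nonneg_of_nonneg_of_le_pi (by linarith) (by linarith)
  rw [Real.norm_of_nonneg (mul_nonneg (by norm_num) hsin), mul_assoc]
  rcases le_total (t' - t) Real.pi with hd | hd
  · calc ‖Complex.exp (Complex.I * ((phase M t' - phase M t : ℝ) : ℂ)) - 1‖
        ≤ ‖phase M t' - phase M t‖ := Real.norm_exp_I_mul_ofReal_sub_one_le
      _ = phase M t' - phase M t := Real.norm_of_nonneg (sub_nonneg.2 (phase_mono hM htt'))
      _ ≤ L * (t' - t) := phase_sub_le hM htt'
      _ ≤ _ := by
        gcongr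
        exact jordan _ (by linarith) hd
  · -- For arcs longer than `π` the complementary arc through the angle `0` is used.
    have hperiod : Complex.exp (Complex.I * ((phase M t' - phase M t : ℝ) : ℂ)) =
        Complex.exp (Complex.I * ((phase M t' - phase M t - 2 * Real.pi : ℝ) : ℂ)) := by
      rw [← Complex.exp_periodic (Complex.I * ((phase M t' - phase M t - 2 * Real.pi : ℝ) : ℂ))]
      congr 1
      push_cast
      ring
    have h1 := phase_sub_le hM ht
    have h2 := phase_sub_le hM ht'.le
    have h3 := phase_mono hM ht
    have h4 := phase_mono hM ht'.le
    rw [phase_zero hM] at h1 h3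
    rw [phase_two_pi hM] at h2 h4
    rw [hperiod]
    calc ‖Complex.exp (Complex.I * ((phase M t' - phase M t - 2 * Real.pi : ℝ) : ℂ)) - 1‖
        ≤ ‖phase M t' - phase M t - 2 * Real.pi‖ := Real.norm_exp_I_mul_ofReal_sub_one_le
      _ = 2 * Real.pi - (phase M t' - phase M t) := by
        rw [Real.norm_of_nonpos (by linarith)]; ring
      _ ≤ L * (2 * Real.pi - (t' - t)) := by linarith
      _ ≤ L * (Real.pi / 2 * (2 * Real.sin ((2 * Real.pi - (t' - t)) / 2))) := by
        gcongr
        exact jordan _ (by linarith) (by linarith)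
      _ = _ := by
        rw [show (2 * Real.pi - (t' - t)) / 2 = Real.pi - (t' - t) / 2 by ring, Real.sin_pi_sub]

lemma norm_exp_phase_sub_le {M t t' : ℝ} (hM : 1 < M) (ht : t ∈ Ico 0 (2 * Real.pi))
    (ht' : t' ∈ Ico 0 (2 * Real.pi)) :
    ‖Complex.exp (Complex.I * (phase M t' : ℂ)) - Complex.exp (Complex.I * (phase M t : ℂ))‖ ≤
      (cConst M)⁻¹ * M * (Real.pi / 2) *
        ‖Complex.exp (Complex.I * (t' : ℂ)) - Complex.exp (Complex.I * (t : ℂ))‖ := by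
  rcases le_total t t' with h | h
  · exact norm_exp_phase_sub_le_of_le hM ht.1 h ht'.2
  · rw [norm_sub_rev, norm_sub_rev (Complex.exp (Complex.I * (t' : ℂ)))]
    exact norm_exp_phase_sub_le_of_le hM ht'.1 h ht.2

lemma exp_I_mul_angle_arg {z : ℂ} (hz : z ≠ 0) :
    Complex.exp (Complex.I * (angle z.arg : ℂ)) = z / ‖z‖ := by
  obtain ⟨n, hn⟩ := exists_eq_angle_add z.arg
  have h : (‖z‖ : ℂ) ≠ 0 := by exact_mod_cast norm_ne_zero_iff.2 hz
  rw [eq_div_iff h]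
  conv_rhs => rw [← Complex.norm_mul_exp_arg_mul_I z, hn]
  rw [mul_comm]
  congr 1
  rw [← Complex.exp_periodic.int_mul n]
  congr 1
  push_cast
  ring

lemma norm_div_norm_sub_le {z z' : ℂ} (hz : z ≠ 0) (hz' : z' ≠ 0) :
    ‖z / ‖z‖ - z' / ‖z'‖‖ ≤ 2 * (‖z - z'‖ / ‖z'‖) := by
  have h : (‖z‖ : ℂ) ≠ 0 := by exact_mod_cast norm_ne_zero_iff.2 hz
  have h' : (‖z'‖ : ℂ) ≠ 0 := by exact_mod_cast norm_ne_zero_iff.2 hz'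
  have h0 : 0 < ‖z'‖ := norm_pos_iff.2 hz'
  have e : z / ‖z‖ - z' / ‖z'‖ =
      (z - z') / ‖z'‖ + z / ‖z‖ * (((‖z'‖ - ‖z‖ : ℝ) : ℂ) / ‖z'‖) := by
    push_cast
    field_simp
    ring
  have e1 : ‖z / (‖z‖ : ℂ)‖ = 1 := by
    rw [norm_div, Complex.norm_real, norm_norm, div_self (norm_ne_zero_iff.2 hz)]
  rw [e]
  refine (norm_add_le _ _).trans ?_
  rw [norm_mul, e1, one_mul, norm_div, norm_div, Complex.norm_real, Complex.norm_real, norm_norm,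
    two_mul]
  gcongr
  rw [norm_sub_rev z z']
  exact abs_norm_sub_norm_le z' z

/-- The map `f₀` is globally Hölder continuous with exponent `1 / c`: the radial factor is, and
the angular factor is Lipschitz on the unit circle. -/
lemma norm_f₀_sub_le {M : ℝ} (hM : 1 < M) : ∃ C : ℝ, 0 < C ∧ ∀ z z' : ℂ,
    ‖f₀ M z - f₀ M z'‖ ≤ C * ‖z - z'‖ ^ (cConst M)⁻¹ := by
  set a := (cConst M)⁻¹ with ha
  have ha0 : 0 < a := inv_cConst_pos hM
  have ha1 : a < 1 := inv_cConst_lt_one hM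
  set K := a * M * (Real.pi / 2) with hK
  have hK0 : 0 < K := by positivity
  refine ⟨3 + 2 * K, by positivity, ?_⟩
  suffices H : ∀ z z' : ℂ, ‖z'‖ ≤ ‖z‖ → ‖f₀ M z - f₀ M z'‖ ≤ (3 + 2 * K) * ‖z - z'‖ ^ a by
    intro z z'
    rcases le_total ‖z'‖ ‖z‖ with h | h
    · exact H z z' h
    · rw [norm_sub_rev, norm_sub_rev z]
      exact H z' z h
  intro z z' hle
  rcases eq_or_ne z' 0 with rfl | hz'
  · have h0 : f₀ M 0 = 0 := by
      rw [← norm_eq_zero, norm_f₀ hM, norm_zero, Real.zero_rpow ha0.ne']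
    rw [h0, sub_zero, sub_zero, norm_f₀ hM]
    have : 0 ≤ ‖z‖ ^ a := by positivity
    nlinarith
  have hr : 0 < ‖z'‖ := norm_pos_iff.2 hz'
  have hz : z ≠ 0 := norm_pos_iff.1 (hr.trans_le hle)
  let E : ℂ → ℂ := fun w ↦
    Complex.exp (Complex.I * ((phase M (angle w.arg) - 3 * Real.pi / 4 : ℝ) : ℂ))
  have hE (w : ℂ) : ‖E w‖ = 1 := Complex.norm_exp_I_mul_ofReal _
  have hEsub : ‖E z - E z'‖ ≤ 2 * K * (‖z - z'‖ / ‖z'‖) := by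
    have h1 : ‖E z - E z'‖ ≤ K * ‖z / ‖z‖ - z' / ‖z'‖‖ := by
      simp only [E]
      rw [← exp_I_mul_angle_arg hz, ← exp_I_mul_angle_arg hz', norm_exp_sub_exp,
        sub_sub_sub_cancel_right, ← norm_exp_sub_exp]
      exact norm_exp_phase_sub_le hM (angle_mem _) (angle_mem _)
    have h2 := mul_le_mul_of_nonneg_left (norm_div_norm_sub_le hz hz') hK0.le
    linarith
  have hE2 : ‖E z - E z'‖ ≤ 2 := by
    refine (norm_sub_le _ _).trans ?_
    rw [hE, hE]; norm_num
  have hang : ‖z'‖ ^ a * ‖E z - E z'‖ ≤ (2 + 2 * K) * ‖z - z'‖ ^ a := by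
    have hd0 : 0 ≤ ‖z - z'‖ ^ a := by positivity
    rcases le_total ‖z'‖ ‖z - z'‖ with hd | hd
    · have := Real.rpow_le_rpow hr.le hd ha0.le
      calc ‖z'‖ ^ a * ‖E z - E z'‖ ≤ ‖z - z'‖ ^ a * 2 := by gcongr
        _ ≤ _ := by nlinarith
    · have hq1 : ‖z - z'‖ / ‖z'‖ ≤ 1 := (div_le_one hr).2 hd
      have hq : ‖z - z'‖ / ‖z'‖ ≤ (‖z - z'‖ / ‖z'‖) ^ a :=
        Real.self_le_rpow_of_le_one (by positivity) hq1 ha1.le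
      calc ‖z'‖ ^ a * ‖E z - E z'‖ ≤ ‖z'‖ ^ a * (2 * K * (‖z - z'‖ / ‖z'‖) ^ a) := by
            gcongr
            exact hEsub.trans (by gcongr)
        _ = 2 * K * ‖z - z'‖ ^ a := by
            rw [Real.div_rpow (norm_nonneg _) hr.le]
            have : ‖z'‖ ^ a ≠ 0 := (Real.rpow_pos_of_pos hr a).ne'
            field_simp
        _ ≤ _ := by nlinarith
  have hrad : |‖z‖ ^ a - ‖z'‖ ^ a| ≤ ‖z - z'‖ ^ a := by
    have h1 := Real.rpow_add_le_add_rpow (sub_nonneg.2 hle) hr.le ha0.le ha1.le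
    rw [sub_add_cancel] at h1
    have h2 : (‖z‖ - ‖z'‖) ^ a ≤ ‖z - z'‖ ^ a :=
      Real.rpow_le_rpow (sub_nonneg.2 hle) (norm_sub_norm_le z z') ha0.le
    rw [abs_of_nonneg (sub_nonneg.2 (Real.rpow_le_rpow hr.le hle ha0.le))]
    linarith
  have hsplit : f₀ M z - f₀ M z' = ((‖z‖ ^ a - ‖z'‖ ^ a : ℝ) : ℂ) * E z +
      ((‖z'‖ ^ a : ℝ) : ℂ) * (E z - E z') := by
    rw [f₀_eq_phase hM, f₀_eq_phase hM]
    simp only [E]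
    push_cast
    ring
  rw [hsplit]
  refine (norm_add_le _ _).trans ?_
  rw [norm_mul, norm_mul, hE, mul_one, Complex.norm_real, Complex.norm_real, Real.norm_eq_abs,
    Real.norm_of_nonneg (by positivity : 0 ≤ ‖z'‖ ^ a)]
  linarith

lemma continuous_f₀ {M : ℝ} (hM : 1 < M) : Continuous (f₀ M) := by
  obtain ⟨C, -, h⟩ := norm_f₀_sub_le hM
  refine continuous_iff_continuousAt.2 fun z ↦ tendsto_iff_norm_sub_tendsto_zero.2 ?_
  refine squeeze_zero (fun _ ↦ norm_nonneg _) (fun w ↦ h w z) ?_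
  have hc : Continuous fun w : ℂ ↦ C * ‖w - z‖ ^ (cConst M)⁻¹ :=
    continuous_const.mul (Continuous.rpow_const (by fun_prop)
      fun _ ↦ Or.inr (inv_cConst_pos hM).le)
  have := hc.tendsto z
  simpa [Real.zero_rpow (inv_cConst_pos hM).ne'] using this

lemma isHolderIn_f₀ {M : ℝ} (hM : 1 < M) (Ω : Set ℂ) : IsHolderIn Ω (cConst M)⁻¹ (f₀ M) := by
  obtain ⟨C, hC, h⟩ := norm_f₀_sub_le hM
  refine fun T _ _ ↦ ⟨C, hC, fun z _ z' _ hne ↦ ?_⟩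
  rw [div_le_iff₀ (Real.rpow_pos_of_pos (norm_pos_iff.2 (sub_ne_zero.2 hne)) _)]
  exact h z z'

/-- Since `‖f₀ z‖ = ‖z‖ ^ (1 / c)`, no Hölder exponent exceeds `1 / c`. -/
lemma IsHolderIn.le_inv_cConst {M α : ℝ} (hM : 1 < M) (h : IsHolderIn (ball 0 1) α (f₀ M)) :
    α ≤ (cConst M)⁻¹ := by
  set a := (cConst M)⁻¹ with ha
  have ha0 : 0 < a := inv_cConst_pos hM
  by_contra! hlt
  obtain ⟨C, hC, hh⟩ := h (closedBall 0 (1 / 2)) (isCompact_closedBall _ _)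
    (closedBall_subset_ball (by norm_num))
  have hβ : 0 < α - a := sub_pos.2 hlt
  set r := min (1 / 2) ((C + 1) ^ (-(α - a)⁻¹)) with hr
  have hC1 : 0 < (C + 1) ^ (-(α - a)⁻¹) := Real.rpow_pos_of_pos (by linarith) _
  have hr0 : 0 < r := lt_min (by norm_num) hC1
  have hnorm : ‖(r : ℂ)‖ = r := by rw [Complex.norm_real, Real.norm_of_nonneg hr0.le]
  have hf0 : f₀ M 0 = 0 := by
    rw [← norm_eq_zero, norm_f₀ hM, norm_zero, Real.zero_rpow ha0.ne']
  have key := hh (r : ℂ) (by rw [mem_closedBall_zero_iff, hnorm]; exact min_le_left _ _) 0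
    (by simp) (by exact_mod_cast hr0.ne')
  rw [hf0, sub_zero, sub_zero, norm_f₀ hM, hnorm, ← ha, ← Real.rpow_sub hr0] at key
  have h2 : C + 1 ≤ r ^ (a - α) := by
    calc C + 1 = ((C + 1) ^ (-(α - a)⁻¹)) ^ (a - α) := by
          rw [← Real.rpow_mul (by linarith), show -(α - a)⁻¹ * (a - α) = 1 by
            rw [← neg_sub α a]; field_simp, Real.rpow_one]
      _ ≤ r ^ (a - α) :=
          Real.rpow_le_rpow_of_nonpos hr0 (min_le_right _ _) (by linarith)
  linarith

/-! ### Weak derivatives of continuous functions differentiable on almost every line -/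

/-- A continuous function which on almost every line in the direction `v` has derivative `g`
outside a countable set has weak derivative `g` in the direction `v`, provided `g` is locally
integrable. The lines are parametrized by a measure-preserving map `(s, t) ↦ s w + t v`. -/
lemma isWeakDeriv_of_hasDerivAt_off_countable {Ω : Set ℂ} {v w : ℂ} {f g : ℂ → ℂ}
    (e : ℝ × ℝ ≃ᵐ ℂ) (he : MeasurePreserving e) (hew : ∀ s t : ℝ, e (s, t) = s * w + t * v)
    (hle : ∀ s t : ℝ, |t| ≤ ‖(s : ℂ) * w + t * v‖)
    (hf : Continuous f) (hg : LocallyIntegrable g)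
    (hderiv : ∀ᵐ s : ℝ, ∃ N : Set ℝ, N.Countable ∧ ∀ t ∉ N,
      HasDerivAt (fun t : ℝ ↦ f (s * w + t * v)) (g (s * w + t * v)) t) :
    IsWeakDeriv Ω v f g := by
  refine ⟨hf.locallyIntegrable.locallyIntegrableOn Ω, hg.locallyIntegrableOn Ω,
    fun φ hφ hφc hφΩ ↦ ?_⟩
  have hφ' : Continuous fun z ↦ fderiv ℝ φ z v := by
    exact (hφ.continuous_fderiv (by simp)).clm_apply continuous_const
  have hφ'c : HasCompactSupport fun z ↦ fderiv ℝ φ z v := hφc.fderiv_apply ℝ v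
  have hi1 : Integrable fun z ↦ fderiv ℝ φ z v • f z :=
    (hφ'.smul hf).integrable_of_hasCompactSupport hφ'c.smul_right
  have hi2 : Integrable fun z ↦ φ z • g z :=
    hg.integrable_smul_left_of_hasCompactSupport hφ.continuous hφc
  have hs1 : ∫ z in Ω, fderiv ℝ φ z v • f z = ∫ z, fderiv ℝ φ z v • f z := by
    refine setIntegral_eq_integral_of_forall_compl_eq_zero fun z hz ↦ ?_
    rw [image_eq_zero_of_notMem_tsupport (f := fderiv ℝ φ)
      fun h ↦ hz (hφΩ (tsupport_fderiv_subset ℝ h))]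
    simp
  have hs2 : ∫ z in Ω, φ z • g z = ∫ z, φ z • g z := by
    refine setIntegral_eq_integral_of_forall_compl_eq_zero fun z hz ↦ ?_
    rw [image_eq_zero_of_notMem_tsupport fun h ↦ hz (hφΩ h), zero_smul]
  rw [hs1, hs2, eq_neg_iff_add_eq_zero, ← integral_add hi1 hi2, ← he.integral_comp',
    Measure.volume_eq_prod, integral_prod]
  swap
  · exact (he.integrable_comp_emb e.measurableEmbedding).2 (hi1.add hi2)
  refine integral_eq_zero_of_ae ?_
  have hslice : ∀ᵐ s : ℝ, Integrable fun t : ℝ ↦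
      fderiv ℝ φ (e (s, t)) v • f (e (s, t)) + φ (e (s, t)) • g (e (s, t)) := by
    have := (he.integrable_comp_emb e.measurableEmbedding).2 (hi1.add hi2)
    rw [Measure.volume_eq_prod] at this
    exact this.prod_right_ae
  obtain ⟨R, hR⟩ := hφc.isCompact.isBounded.subset_ball 0
  filter_upwards [hderiv, hslice] with s ⟨N, hN, hd⟩ hint
  simp only [hew] at hint ⊢
  have hfar (t : ℝ) (ht : R ≤ |t|) : (s : ℂ) * w + t * v ∉ tsupport φ := fun h ↦ by
    have := mem_ball_zero_iff.1 (hR h)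
    linarith [hle s t]
  let R' := max R 0
  have hR'0 : 0 ≤ R' := le_max_right _ _
  have hsupp (t : ℝ) (ht : t ∉ Ioc (-R') R') :
      fderiv ℝ φ (s * w + t * v) v • f (s * w + t * v) + φ (s * w + t * v) • g (s * w + t * v)
        = 0 := by
    have hfar' := hfar t (by
      rw [mem_Ioc, not_and_or, not_lt, not_le] at ht
      refine (le_max_left R 0).trans (le_abs'.2 ?_)
      rcases ht with h | h
      · exact Or.inl h
      · exact Or.inr h.le)
    rw [image_eq_zero_of_notMem_tsupport hfar', image_eq_zero_of_notMem_tsupport (f := fderiv ℝ φ)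
      fun h ↦ hfar' (tsupport_fderiv_subset ℝ h)]
    simp
  rw [Pi.zero_apply, ← setIntegral_eq_integral_of_forall_compl_eq_zero hsupp,
    ← intervalIntegral.integral_of_le (by linarith)]
  have hline : Continuous fun t : ℝ ↦ (s : ℂ) * w + t * v := by fun_prop
  rw [MeasureTheory.integral_eq_of_hasDerivAt_off_countable
    (fun t : ℝ ↦ φ (s * w + t * v) • f (s * w + t * v)) _ hN]
  · rw [image_eq_zero_of_notMem_tsupport (hfar R' ((le_max_left _ _).trans (le_abs_self _))),
      image_eq_zero_of_notMem_tsupport (hfar (-R') (by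
        rw [abs_neg]; exact (le_max_left _ _).trans (le_abs_self _)))]
    simp
  · exact ((hφ.continuous.comp hline).smul (hf.comp hline)).continuousOn
  · intro t ht
    have hl : HasDerivAt (fun t : ℝ ↦ (s : ℂ) * w + t * v) v t := by
      simpa using ((hasDerivAt_id t).ofReal_comp.mul_const v).const_add ((s : ℂ) * w)
    have hφd := ((hφ.differentiable (by simp)) (s * w + t * v)).hasFDerivAt.comp_hasDerivAt t hl
    have := hφd.smul (hd t ht.2)
    rw [add_comm] at this
    exact this
  · exact hint.intervalIntegrable

/-! ### The weak gradient of `f₀` -/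

/-- The derivative of `f₀` in the direction `v`: on each sector `f₀` is a constant multiple of
`exp (c⁻¹ Re (log z) + i c⁻¹ k₀ Im (log z))`. -/
def dirDeriv (M : ℝ) (v z : ℂ) : ℂ :=
  (cConst M)⁻¹ * f₀ M z * (((v / z).re : ℂ) + Complex.I * (k₀ M z.arg * (v / z).im : ℝ))

/-- The phase is locally affine with slope `c⁻¹ k₀`, away from the four rays where `k₀` jumps. -/
lemma exists_phase_eq {M θ : ℝ} (hM : 1 < M) (hθ : θ ∈ Ioo (-Real.pi) Real.pi) (h0 : θ ≠ 0)
    (h1 : θ ≠ cConst M * Real.pi / 2) (h2 : θ ≠ cConst M * Real.pi / 2 - Real.pi) :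
    ∃ lo hi β : ℝ, θ ∈ Ioo lo hi ∧ ∀ x ∈ Ioo lo hi,
      k₀ M x = k₀ M θ ∧ phase M (angle x) = (cConst M)⁻¹ * (k₀ M θ * x) + β := by
  have hpi := Real.pi_pos
  have hc := cConst_lt_two hM
  have hc1 := one_lt_cConst hM
  set b := cConst M * Real.pi / 2 with hb
  have hcb : cConst M * Real.pi = 2 * b := by rw [hb]; ring
  have hb0 : 0 < b := by positivity
  have hbpi : b < Real.pi := by nlinarith
  have hang (x : ℝ) (hx : x ∈ Ico 0 Real.pi) : angle x = x :=
    angle_of_mem ⟨hx.1, by linarith [hx.2]⟩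
  have hang' (x : ℝ) (hx : x ∈ Ico (-Real.pi) 0) : angle x = x + 2 * Real.pi := by
    have := angle_add_int_mul x 1
    rw [Int.cast_one, one_mul] at this
    rw [← this]
    exact angle_of_mem ⟨by linarith [hx.1], by linarith [hx.2]⟩
  -- It suffices to know `k₀` and the phase on each open sector.
  suffices H : ∃ lo hi κ β : ℝ, θ ∈ Ioo lo hi ∧ ∀ x ∈ Ioo lo hi,
      k₀ M x = κ ∧ phase M (angle x) = (cConst M)⁻¹ * (κ * x) + β by
    obtain ⟨lo, hi, κ, β, hmem, h⟩ := H
    refine ⟨lo, hi, β, hmem, ?_⟩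
    rw [(h θ hmem).1]
    exact h
  rcases lt_or_gt_of_ne h0 with hneg | hpos
  · rcases lt_or_gt_of_ne h2 with hlt | hgt
    · refine ⟨-Real.pi, b - Real.pi, 1, (cConst M)⁻¹ * Real.pi + Real.pi, ⟨hθ.1, hlt⟩,
        fun x hx ↦ ?_⟩
      have ha := hang' x ⟨hx.1.le, by linarith [hx.2]⟩
      have hx1 := hx.1
      have hx2 := hx.2
      constructor
      · rw [k₀, ha, ← hb, if_pos (mem_union_right _ (mem_Ico.2 ⟨by linarith, by linarith⟩))]
      · rw [ha, phase_of_mem_third hM (by linarith) (by linarith)]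
        ring
    · refine ⟨b - Real.pi, 0, M,
        (cConst M)⁻¹ * M * (Real.pi - b) + 3 * Real.pi / 2, ⟨hgt, hneg⟩, fun x hx ↦ ?_⟩
      have hx1 := hx.1
      have hx2 := hx.2
      have ha := hang' x ⟨by linarith, hx2⟩
      constructor
      · rw [k₀, ha, ← hb, if_neg]
        rintro (⟨_, h⟩ | ⟨_, h⟩) <;> linarith
      · rw [ha, phase_of_le hM (by linarith), ← hb]
        ring
  · rcases lt_or_gt_of_ne h1 with hlt | hgt
    · refine ⟨0, b, 1, 0, ⟨hpos, hlt⟩, fun x hx ↦ ?_⟩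
      have hx1 := hx.1
      have hx2 := hx.2
      have ha := hang x ⟨hx1.le, by linarith⟩
      constructor
      · rw [k₀, ha, ← hb, if_pos (mem_union_left _ (mem_Ico.2 ⟨hx1.le, hx2⟩))]
      · rw [ha, phase_of_lt hM hx2]
        ring
    · refine ⟨b, Real.pi, M, -((cConst M)⁻¹ * M * b) + Real.pi / 2, ⟨hgt, hθ.2⟩, fun x hx ↦ ?_⟩
      have hx1 := hx.1
      have hx2 := hx.2
      have ha := hang x ⟨by linarith, hx2⟩
      constructor
      · rw [k₀, ha, ← hb, if_neg]
        rintro (⟨_, h⟩ | ⟨h, _⟩) <;> linarith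
      · rw [ha, phase_of_mem_second hM hx1.le hx2, ← hb]
        ring

lemma hasDerivAt_f₀_comp {M : ℝ} (hM : 1 < M) {γ : ℝ → ℂ} {v : ℂ} {t : ℝ}
    (hγ : HasDerivAt γ v t) (him : (γ t).im ≠ 0)
    (hd : (γ t * conj (Complex.exp (Complex.I * (cConst M * Real.pi / 2 : ℝ)))).im ≠ 0) :
    HasDerivAt (fun t ↦ f₀ M (γ t)) (dirDeriv M v (γ t)) t := by
  set b := cConst M * Real.pi / 2 with hb
  have hslit : γ t ∈ Complex.slitPlane := Or.inr him
  have hz0 : γ t ≠ 0 := Complex.slitPlane_ne_zero hslit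
  have hmem : (γ t).arg ∈ Ioo (-Real.pi) Real.pi :=
    ⟨Complex.neg_pi_lt_arg _, (Complex.arg_le_pi _).lt_of_ne fun h ↦
      him (Complex.arg_eq_pi_iff.1 h).2⟩
  have h0 : (γ t).arg ≠ 0 := fun h ↦ him (Complex.arg_eq_zero_iff.1 h).2
  have hexp : γ t * conj (Complex.exp (Complex.I * (b : ℝ))) =
      ‖γ t‖ * Complex.exp (((γ t).arg - b : ℝ) * Complex.I) := by
    conv_lhs => rw [← Complex.norm_mul_exp_arg_mul_I (γ t)]
    rw [← Complex.exp_conj, mul_assoc, ← Complex.exp_add]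
    congr 2
    simp
    ring
  rw [hexp, Complex.im_ofReal_mul, Complex.exp_ofReal_mul_I_im] at hd
  have h1 : (γ t).arg ≠ b := fun h ↦ hd (by simp [h])
  have h2 : (γ t).arg ≠ b - Real.pi := fun h ↦ hd (by simp [h])
  obtain ⟨lo, hi, β, harg, hphase⟩ := exists_phase_eq hM hmem h0 h1 h2
  set a := (cConst M)⁻¹ with ha
  set κ := k₀ M (γ t).arg with hκ
  let F : ℝ → ℂ := fun τ ↦ Complex.exp (((a * (Complex.log (γ τ)).re : ℝ) : ℂ) +
    Complex.I * ((a * (κ * (Complex.log (γ τ)).im) + β - 3 * Real.pi / 4 : ℝ) : ℂ))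
  have hFeq (τ : ℝ) (hne : γ τ ≠ 0) (hτ : (γ τ).arg ∈ Ioo lo hi) : f₀ M (γ τ) = F τ := by
    rw [f₀_eq_phase hM, (hphase _ hτ).2]
    simp only [F]
    rw [Complex.exp_add, ← Complex.ofReal_exp, Complex.log_re, Complex.log_im,
      Real.rpow_def_of_pos (norm_pos_iff.2 hne), mul_comm a (Real.log _)]
  have hev : (fun τ ↦ f₀ M (γ τ)) =ᶠ[nhds t] F := by
    have hc1 : ∀ᶠ τ in nhds t, γ τ ≠ 0 := hγ.continuousAt.eventually_ne hz0
    have hc2 : ∀ᶠ τ in nhds t, (γ τ).arg ∈ Ioo lo hi :=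
      ((Complex.continuousAt_arg hslit).comp hγ.continuousAt).eventually_mem
        (isOpen_Ioo.mem_nhds harg)
    filter_upwards [hc1, hc2] with τ hτ1 hτ2 using hFeq τ hτ1 hτ2
  have hlog : HasDerivAt (fun τ ↦ Complex.log (γ τ)) (v / γ t) t := hγ.clog_real hslit
  have hre : HasDerivAt (fun τ ↦ (Complex.log (γ τ)).re) (v / γ t).re t :=
    Complex.reCLM.hasFDerivAt.comp_hasDerivAt t hlog
  have him' : HasDerivAt (fun τ ↦ (Complex.log (γ τ)).im) (v / γ t).im t :=
    Complex.imCLM.hasFDerivAt.comp_hasDerivAt t hlog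
  have hF : HasDerivAt F (F t * (((a * (v / γ t).re : ℝ) : ℂ) +
      Complex.I * ((a * (κ * (v / γ t).im) : ℝ) : ℂ))) t :=
    ((hre.const_mul a).ofReal_comp.add
      (HasDerivAt.const_mul Complex.I ((((him'.const_mul κ).const_mul a).add_const β).sub_const
        (3 * Real.pi / 4)).ofReal_comp)).cexp
  refine (hF.congr_of_eventuallyEq hev).congr_deriv ?_
  rw [← hFeq t hz0 harg, dirDeriv, ← ha, ← hκ]
  push_cast
  ring

lemma measurable_dirDeriv {M : ℝ} (hM : 1 < M) (v : ℂ) : Measurable (dirDeriv M v) := by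
  have h1 : Measurable fun z : ℂ ↦ k₀ M z.arg := (measurable_k₀ M).comp Complex.measurable_arg
  have h2 := (continuous_f₀ hM).measurable
  have h3 : Measurable fun z : ℂ ↦ (v / z).re := Complex.measurable_re.comp (by fun_prop)
  have h4 : Measurable fun z : ℂ ↦ (v / z).im := Complex.measurable_im.comp (by fun_prop)
  unfold dirDeriv
  fun_prop

lemma norm_dirDeriv_le {M : ℝ} (hM : 1 < M) (v z : ℂ) :
    ‖dirDeriv M v z‖ ≤ 2 * M * ‖v‖ * ‖z‖ ^ ((cConst M)⁻¹ - 1) := by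
  rcases eq_or_ne z 0 with rfl | hz
  · have : dirDeriv M v 0 = 0 := by simp [dirDeriv]
    rw [this, norm_zero]
    positivity
  have ha0 := inv_cConst_pos hM
  have ha1 := inv_cConst_lt_one hM
  have hk := one_le_k₀ hM z.arg
  have hq : ‖((v / z).re : ℂ) + Complex.I * (k₀ M z.arg * (v / z).im : ℝ)‖ ≤
      2 * M * (‖v‖ / ‖z‖) := by
    refine (norm_add_le _ _).trans ?_
    rw [norm_mul, Complex.norm_I, one_mul, Complex.norm_real, Complex.norm_real, Real.norm_eq_abs,
      Real.norm_eq_abs, abs_mul, abs_of_pos (by linarith : 0 < k₀ M z.arg), ← norm_div]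
    have h1 := Complex.abs_re_le_norm (v / z)
    have h2 := mul_le_mul (k₀_le hM z.arg) (Complex.abs_im_le_norm (v / z)) (abs_nonneg _)
      (by linarith)
    nlinarith [norm_nonneg (v / z)]
  rw [dirDeriv, norm_mul, norm_mul, norm_f₀ hM, Complex.norm_real,
    Real.norm_of_nonneg ha0.le, Real.rpow_sub (norm_pos_iff.2 hz), Real.rpow_one]
  calc (cConst M)⁻¹ * ‖z‖ ^ (cConst M)⁻¹ *
        ‖((v / z).re : ℂ) + Complex.I * (k₀ M z.arg * (v / z).im : ℝ)‖
      ≤ 1 * ‖z‖ ^ (cConst M)⁻¹ * (2 * M * (‖v‖ / ‖z‖)) := by gcongr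
    _ = 2 * M * ‖v‖ * (‖z‖ ^ (cConst M)⁻¹ / ‖z‖) := by ring

/-- The gradient is square integrable because `‖z‖ ^ (2 / c - 2)` is integrable in the plane. -/
lemma memLp_dirDeriv {M : ℝ} (hM : 1 < M) (v : ℂ) (R : ℝ) :
    MemLp (dirDeriv M v) 2 (volume.restrict (ball 0 R)) := by
  have hm := (measurable_dirDeriv hM v).aestronglyMeasurable (μ := volume.restrict (ball 0 R))
  rw [memLp_two_iff_integrable_sq_norm hm]
  set p := 2 * ((cConst M)⁻¹ - 1) with hp
  have hint : IntegrableOn (fun z : ℂ ↦ (2 * M * ‖v‖) ^ 2 * ‖z‖ ^ p) (ball 0 R) := by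
    refine Integrable.const_mul ?_ _
    refine (integrableOn_fun_norm_addHaar (volume : Measure ℂ) (f := fun y ↦ y ^ p)).2 ?_
    have h1 : IntegrableOn (fun y : ℝ ↦ y ^ (p + 1)) (Ioo 0 R) := by
      rcases le_or_gt R 0 with hR | hR
      · simp [Ioo_eq_empty_of_le hR]
      · exact (intervalIntegral.integrableOn_Ioo_rpow_iff hR).2
          (by have := half_lt_inv_cConst hM; linarith)
    refine h1.congr_fun (fun y hy ↦ ?_) measurableSet_Ioo
    simp only
    rw [Complex.finrank_real_complex, Real.rpow_add hy.1, Real.rpow_one]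
    simp [mul_comm]
  refine hint.mono' (hm.norm.pow 2) (Filter.Eventually.of_forall fun z ↦ ?_)
  rw [Real.norm_of_nonneg (sq_nonneg _), hp, mul_comm 2 ((cConst M)⁻¹ - 1),
    Real.rpow_mul (norm_nonneg z), Real.rpow_two, ← mul_pow]
  exact pow_le_pow_left₀ (norm_nonneg _) (norm_dirDeriv_le hM v z) 2

lemma locallyIntegrable_dirDeriv {M : ℝ} (hM : 1 < M) (v : ℂ) :
    LocallyIntegrable (dirDeriv M v) := fun z ↦
  ⟨ball 0 (‖z‖ + 1), isOpen_ball.mem_nhds (by simp), by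
    have : IsFiniteMeasure (volume.restrict (ball (0 : ℂ) (‖z‖ + 1))) :=
      ⟨by rw [Measure.restrict_apply_univ]; exact measure_ball_lt_top⟩
    exact (memLp_dirDeriv hM v (‖z‖ + 1)).integrable one_le_two⟩

/-- A line missing the origin meets each line through the origin in at most one point. -/
lemma subsingleton_setOf_im_eq_zero {v w d : ℂ} {s : ℝ} (hs : s ≠ 0)
    (hvw : (v * conj d).im = 0 → (w * conj d).im ≠ 0) :
    {t : ℝ | (((s : ℂ) * w + t * v) * conj d).im = 0}.Subsingleton := by
  have hlin (t : ℝ) : (((s : ℂ) * w + t * v) * conj d).im =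
      s * (w * conj d).im + t * (v * conj d).im := by
    rw [add_mul, mul_assoc, mul_assoc, Complex.add_im, Complex.im_ofReal_mul,
      Complex.im_ofReal_mul]
  intro t ht t' ht'
  rw [mem_ofPred_eq, hlin] at ht ht'
  by_contra hne
  have h1 : (v * conj d).im = 0 := by
    have : (t - t') * (v * conj d).im = 0 := by linarith
    exact (mul_eq_zero.1 this).resolve_left (sub_ne_zero.2 hne)
  rw [h1, mul_zero, add_zero] at ht
  exact (mul_ne_zero hs (hvw h1)) ht

lemma isWeakDeriv_f₀ {M : ℝ} (hM : 1 < M) (Ω : Set ℂ) {v w : ℂ} (e : ℝ × ℝ ≃ᵐ ℂ)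
    (he : MeasurePreserving e) (hew : ∀ s t : ℝ, e (s, t) = s * w + t * v)
    (hle : ∀ s t : ℝ, |t| ≤ ‖(s : ℂ) * w + t * v‖)
    (hvw : ∀ d : ℂ, d ≠ 0 → (v * conj d).im = 0 → (w * conj d).im ≠ 0) :
    IsWeakDeriv Ω v (f₀ M) (dirDeriv M v) := by
  refine isWeakDeriv_of_hasDerivAt_off_countable e he hew hle (continuous_f₀ hM)
    (locallyIntegrable_dirDeriv hM v) ?_
  have hne : ∀ᵐ s : ℝ, s ≠ 0 := by simp [ae_iff]
  filter_upwards [hne] with s hs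
  set d := Complex.exp (Complex.I * (cConst M * Real.pi / 2 : ℝ)) with hd
  refine ⟨{t : ℝ | (((s : ℂ) * w + t * v) * conj 1).im = 0} ∪
    {t : ℝ | (((s : ℂ) * w + t * v) * conj d).im = 0},
    (subsingleton_setOf_im_eq_zero hs (hvw 1 one_ne_zero)).countable.union
      (subsingleton_setOf_im_eq_zero hs (hvw d (Complex.exp_ne_zero _))).countable,
    fun t ht ↦ ?_⟩
  rw [mem_union, not_or] at ht
  have hl : HasDerivAt (fun t : ℝ ↦ (s : ℂ) * w + t * v) v t := by
    simpa using ((hasDerivAt_id t).ofReal_comp.mul_const v).const_add ((s : ℂ) * w)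
  refine hasDerivAt_f₀_comp hM hl ?_ ht.2
  simpa using ht.1

lemma hasWeakGradient_f₀ {M : ℝ} (hM : 1 < M) (Ω : Set ℂ) :
    HasWeakGradient Ω (f₀ M) (dirDeriv M 1) (dirDeriv M Complex.I) := by
  constructor
  · refine isWeakDeriv_f₀ hM Ω (w := Complex.I)
      (MeasurableEquiv.prodComm.trans Complex.measurableEquivRealProd.symm)
      (Complex.volume_preserving_equiv_real_prod.symm.comp Measure.measurePreserving_swap)
      (fun s t ↦ ?_) (fun s t ↦ ?_) fun d hd h1 h2 ↦ hd ?_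
    · apply Complex.ext <;> simp [MeasurableEquiv.prodComm]
    · simpa using Complex.abs_re_le_norm ((s : ℂ) * Complex.I + t * 1)
    · apply Complex.ext <;> simp at h1 h2 ⊢ <;> assumption
  · refine isWeakDeriv_f₀ hM Ω (w := 1) Complex.measurableEquivRealProd.symm
      Complex.volume_preserving_equiv_real_prod.symm
      (fun s t ↦ ?_) (fun s t ↦ ?_) fun d hd h1 h2 ↦ hd ?_
    · apply Complex.ext <;> simp
    · simpa using Complex.abs_im_le_norm ((s : ℂ) * 1 + t * Complex.I)
    · apply Complex.ext <;> simp at h1 h2 ⊢ <;> assumption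

/-! ### The Beltrami equation -/

lemma dirDeriv_beltrami {M : ℝ} (hM : 1 < M) (z : ℂ) :
    (dirDeriv M 1 z + Complex.I * dirDeriv M Complex.I z) / 2 =
      μ₀ M z * ((dirDeriv M 1 z - Complex.I * dirDeriv M Complex.I z) / 2) := by
  rcases eq_or_ne z 0 with rfl | hz
  · simp [dirDeriv]
  have hk := one_le_k₀ hM z.arg
  set k := k₀ M z.arg with hkdef
  have hk1 : (1 + k : ℂ) ≠ 0 := by exact_mod_cast (by linarith : (1 + k : ℝ) ≠ 0)
  -- With `q = 1 / z` the two sides are multiples of `(1 - k) conj q` and `(1 + k) q`.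
  have hre : (Complex.I / z).re = -(1 / z).im := by
    rw [div_eq_mul_one_div Complex.I, Complex.I_mul_re]
  have him : (Complex.I / z).im = (1 / z).re := by
    rw [div_eq_mul_one_div Complex.I, Complex.I_mul_im]
  set A := (((cConst M)⁻¹ : ℝ) : ℂ) * f₀ M z with hA
  obtain ⟨u, hu⟩ : ∃ u : ℝ, (1 / z).re = u := ⟨_, rfl⟩
  obtain ⟨w, hw⟩ : ∃ w : ℝ, (1 / z).im = w := ⟨_, rfl⟩
  have hq : (1 / z : ℂ) = u + w * Complex.I := by
    rw [← hu, ← hw, Complex.re_add_im]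
  have hqc : (1 / conj z : ℂ) = u - w * Complex.I := by
    rw [← map_one conj, ← map_div₀, hq]
    simp [sub_eq_add_neg]
  have hplus : dirDeriv M 1 z + Complex.I * dirDeriv M Complex.I z =
      A * (1 - k) * (1 / conj z) := by
    rw [dirDeriv, dirDeriv, hre, him, hqc, ← hkdef, ← hA, hu, hw]
    push_cast
    linear_combination (A * k * u) * Complex.I_sq
  have hminus : dirDeriv M 1 z - Complex.I * dirDeriv M Complex.I z =
      A * (1 + k) * (1 / z) := by
    rw [dirDeriv, dirDeriv, hre, him, ← hkdef, ← hA, hu, hw, hq]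
    push_cast
    linear_combination (-A * k * u) * Complex.I_sq
  have hcz : conj z ≠ 0 := (map_ne_zero _).2 hz
  rw [hplus, hminus, μ₀, ← hkdef]
  push_cast
  field_simp

lemma isBeltramiCoefficient_μ₀ {M : ℝ} (hM : 1 < M) (Ω : Set ℂ) :
    IsBeltramiCoefficient Ω (μ₀ M) := by
  constructor
  · have h1 : Measurable fun z : ℂ ↦ k₀ M z.arg := (measurable_k₀ M).comp Complex.measurable_arg
    have h2 := Complex.continuous_conj.measurable
    have : Measurable (μ₀ M) := by
      unfold μ₀
      fun_prop
    exact this.aestronglyMeasurable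
  · have hbound (z : ℂ) : ‖μ₀ M z‖ ≤ (M - 1) / (M + 1) := by
      rw [μ₀, norm_mul, Complex.norm_real, Real.norm_eq_abs]
      have hk : |(1 - k₀ M z.arg) / (1 + k₀ M z.arg)| ≤ (M - 1) / (M + 1) := by
        have h0 : 0 ≤ (M - 1) / (M + 1) := div_nonneg (by linarith) (by linarith)
        rcases k₀_eq_one_or M z.arg with h | h
        · rw [h]; simpa using h0
        · rw [h, abs_div, abs_of_neg (by linarith), abs_of_pos (by linarith), neg_sub,
            add_comm 1 M]
      exact (mul_le_mul hk (norm_mul_conj_inv_le z) (norm_nonneg _)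
        ((abs_nonneg _).trans hk)).trans_eq (mul_one _)
    refine (eLpNorm_le_of_ae_bound (Filter.Eventually.of_forall hbound)).trans_lt ?_
    simp only [ENNReal.toReal_top, inv_zero, ENNReal.rpow_zero, one_mul]
    rw [ENNReal.ofReal_lt_one, div_lt_one (by linarith)]
    linarith

lemma memLp_f₀ {M : ℝ} (hM : 1 < M) : MemLp (f₀ M) 2 (volume.restrict (ball 0 1)) := by
  have : IsFiniteMeasure (volume.restrict (ball (0 : ℂ) 1)) :=
    ⟨by rw [Measure.restrict_apply_univ]; exact measure_ball_lt_top⟩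
  refine MemLp.of_bound (continuous_f₀ hM).aestronglyMeasurable 1 ?_
  filter_upwards [ae_restrict_mem measurableSet_ball] with z hz
  rw [norm_f₀ hM]
  exact Real.rpow_le_one (norm_nonneg z) (mem_ball_zero_iff.1 hz).le (inv_cConst_pos hM).le

lemma memW12_f₀ {M : ℝ} (hM : 1 < M) : MemW12 (ball 0 1) (f₀ M) :=
  ⟨_, _, hasWeakGradient_f₀ hM _, memLp_f₀ hM, memLp_dirDeriv hM _ 1, memLp_dirDeriv hM _ 1⟩

lemma solvesBeltrami_f₀ {M : ℝ} (hM : 1 < M) : SolvesBeltrami (ball 0 1) (μ₀ M) (f₀ M) := by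
  have hloc {h : ℂ → ℂ} (hh : MemLp h 2 (volume.restrict (ball 0 1))) : MemL2Loc (ball 0 1) h :=
    fun T _ hT ↦ hh.mono_measure (Measure.restrict_mono hT le_rfl)
  exact ⟨_, _, hasWeakGradient_f₀ hM _, hloc (memLp_f₀ hM), hloc (memLp_dirDeriv hM _ 1),
    hloc (memLp_dirDeriv hM _ 1), Filter.Eventually.of_forall (dirDeriv_beltrami hM)⟩

end

theorem theorem2 :
    (∀ M : ℝ, 1 < M →
      MemW12 (Metric.ball (0 : ℂ) 1) (f₀ M) ∧
      IsBeltramiCoefficient (Metric.ball (0 : ℂ) 1) (μ₀ M) ∧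
      SolvesBeltrami (Metric.ball (0 : ℂ) 1) (μ₀ M) (f₀ M)) ∧
    ∃ Mbar : ℝ, 1 < Mbar ∧ ∀ M : ℝ, 1 < M → M < Mbar →
      (∀ p ∈ circlesIn (Metric.ball (0 : ℂ) 1),
        CircleIntegrable (circleIntegrand (μ₀ M) p.1 p.2) p.1 p.2) ∧
      essSupCircleAverage (Metric.ball (0 : ℂ) 1) (μ₀ M) = ((cConst M : ℝ) : EReal) ∧
      IsGreatest {α : ℝ | 0 < α ∧ α < 1 ∧ IsHolderIn (Metric.ball (0 : ℂ) 1) α (f₀ M)}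
        (cConst M)⁻¹ := by
  refine ⟨fun M hM ↦ ⟨memW12_f₀ hM, isBeltramiCoefficient_μ₀ hM _, solvesBeltrami_f₀ hM⟩,
    6 / 5, by norm_num, fun M hM hM' ↦ ⟨?_, ?_, ?_, ?_⟩⟩
  · exact fun p hp ↦ circleIntegrable_circleIntegrand hM p.1 hp.1
  · exact le_antisymm (essSupCircleAverage_le hM hM' _) (le_essSupCircleAverage hM)
  · exact ⟨inv_cConst_pos hM, inv_cConst_lt_one hM, isHolderIn_f₀ hM _⟩
  · exact fun α hα ↦ IsHolderIn.le_inv_cConst hM hα.2.2
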